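/- **Setting.** Let $[d]$ index the coordinates of a hidden vector $z\in\mathbb R^d$, and let $0\le s\le r\le k$. There are $T$ tasks, a shared feature set $S\subseteq[d]$ with $|S|=s$, and private feature sets $P_1,\dots,P_T\subseteq[d]$ with $|P_i|=r-s$, pairwise disjoint and disjoint from $S$. Put $R_i=S\cup P_i$, $R=\bigcup_{i} R_i$, $U=[d]\setminus R$. In task $\mathcal D_i$ the coordinates of $z$ are independent, $z_{R_i}\sim\mathcal N(0,I)$, $z_{R\setminus R_i}=0$, $z_U\sim\mathcal N(0,I)$; the input is $x=Mz$ with $M\in\mathbb R^{d\times d}$ a fixed orthogonal matrix, and the label is $y=(u_i^*)^\top z_{R_i}$ for some $u_i^*\in\mathbb R^{R_i}$. A positive pair is $(x,x^+)=(Mz,Mz^+)$, where $z^+_R=z_R$ and $z^+_U\sim\mathcal N(0,I)$ is an independent copy of $z_U$; $x^-$ is an independent copy of $x$. Let $\Phi=\{x\mapsto Wx : W\in\mathbb R^{k\times d},\ \|W\|\le 1,\ \|W\|_F\le\sqrt r\}$ (spectral and Frobenius norms). Let $\ell:\mathbb R\to\mathbb R$ be convex and nonincreasing with $\ell(a)<\ell(0)$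 for some $a>0$ (for instance, convex and strictly decreasing). Fix a task $t$; a representation $\phi^*_t$ obtained by pre-training on $\mathcal D_t$ is any minimizer over $\phi\in\Phi$ of $\mathbb E_{(x,x^+)}\big[\ell\big(\phi(x)^\top(\phi(x^+)-\mathbb E_{x^-}\phi(x^-))\big)\big]\in(-\infty,+\infty]$, the expectation being under $\mathcal D_t$. For $\phi\in\Phi$ let $B_{\phi,t}$ be the least $B$ such that some $u\in\mathbb R^k$ with $\|u\|\le B$ satisfies $y=u^\top\phi(x)$ almost surely on $\mathcal D_t$, and let $\mathcal F_{\phi,t}=\{u\in\mathbb R^k:\|u\|\le B_{\phi,t}\}$. The prediction loss $\ell_c:\mathbb R\times\mathbb R\to\mathbb R$ is measurable and $L$-Lipschitz in its first argument (the prediction). **Statement.** 1. For every injection $\iota:R_t\to[k]$, a linear map $\phi(x)=Wx$ is a representation obtained by pre-training on $\mathcal D_t$ if and only if there is an orthogonal $Q\in\mathbb R^{k\times k}$ with $$\phi(Mz)=Q\Big(\sum_{j\in R_t}z_j\,e_{\iota(j)}\Big)\qquad\text{for all }z\in\mathbb R^d .$$ 2. For every such $\phi^*_t$ the least radius $B_{\phi^*_t,t}$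 exists. If moreover $|\ell_c|\le 1$ and $\ell_c(y,y)=0$ for all $y$, then for all $m\ge1$ and $\delta\in(0,1)$, with probability at least $1-\delta$ over $m$ i.i.d. labeled points from $\mathcal D_t$, every empirical risk minimizer $\hat u\in\mathcal F_{\phi^*_t,t}$ on these points satisfies $$\mathbb E_{(x,y)\sim\mathcal D_t}\big[\ell_c(\hat u^\top\phi^*_t(x),y)\big]\le 4L\sqrt{\frac rm}\,\|u_t^*\|+8\sqrt{\frac{2\ln(4/\delta)}{m}} .$$ 3. For every such $\phi^*_t$, every $i\ne t$ and every $v\in\mathbb R^k$, $$\mathbb E_{(x,y)\sim\mathcal D_i}\big[\ell_c(v^\top\phi^*_t(x),y)\big]\ \ge\ \inf_{u\in\mathbb R^S}\mathbb E_{\mathcal D_i}\big[\ell_c(u^\top z_S,y)\big].$$ -/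

import Mathlib

open MeasureTheory ProbabilityTheory
open scoped ENNReal NNReal Matrix

noncomputable section

namespace ContrastiveLinear

/-- The expectation `E[f⁺] - E[f⁻]` of a real random variable, with values in `[-∞, ∞]`.
It is the Bochner integral of `f` when `f` is integrable. -/
def expect {Ω : Type*} [MeasurableSpace Ω] (μ : Measure Ω) (f : Ω → ℝ) : EReal :=
  ((∫⁻ ω, ENNReal.ofReal (f ω) ∂μ : ℝ≥0∞) : EReal) -
    ((∫⁻ ω, ENNReal.ofReal (-f ω) ∂μ : ℝ≥0∞) : EReal)

/-- The parameters of the linear hidden-feature model with `d` features and `T` tasks: shared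
features `S` with `|S| = s`, private features `P t` with `|P t| = r - s`, the orthonormal
dictionary `M`, and the label weights `u*_t`, a vector indexed by `R_t = S ∪ P_t`. -/
structure Model (d T s r : ℕ) where
  S : Finset (Fin d)
  P : Fin T → Finset (Fin d)
  s_le_r : s ≤ r
  card_S : S.card = s
  card_P : ∀ t, (P t).card = r - s
  disjoint_P_S : ∀ t, Disjoint (P t) S
  disjoint_P : ∀ t₁ t₂, t₁ ≠ t₂ → Disjoint (P t₁) (P t₂)
  M : Matrix (Fin d) (Fin d) ℝ
  M_mem : M ∈ Matrix.orthogonalGroup (Fin d) ℝ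
  ustar : ∀ t, EuclideanSpace ℝ {j : Fin d // j ∈ S ∪ P t}

/-- The linear representations `x ↦ W x` from `ℝ^d` to `ℝ^k` with spectral norm at most `1` and
Frobenius norm at most `√r`. -/
def repClass (d k r : ℕ) : Set (Matrix (Fin k) (Fin d) ℝ) :=
  {W | ‖(Matrix.toEuclideanLin W).toContinuousLinearMap‖ ≤ 1 ∧
    √(∑ i, ∑ j, W i j ^ 2) ≤ √(r : ℝ)}

namespace Model

variable {d T s r : ℕ} (D : Model d T s r)

/-- The invariant features `R_t = S ∪ P_t` of task `t`. -/
def Rt (t : Fin T) : Finset (Fin d) := D.S ∪ D.P t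

/-- All invariant features; the spurious features are those outside `R`. -/
def R : Finset (Fin d) := Finset.univ.biUnion D.Rt

/-- The law of the hidden representation `z` in task `t`: independent coordinates, zero on
`R \ R_t` and standard Gaussian on `R_t` and on the spurious features. -/
def hiddenLaw (t : Fin T) : Measure (Fin d → ℝ) :=
  Measure.pi fun j => if j ∈ D.R ∧ j ∉ D.Rt t then Measure.dirac 0 else gaussianReal 0 1

/-- Keeps the invariant coordinates of `z` and takes the spurious coordinates from `w`. -/
def resample (z w : Fin d → ℝ) : Fin d → ℝ := fun j => if j ∈ D.R then z j else w j

/-- The law of the input `x = M z` in task `t`. -/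
def inputLaw (t : Fin T) : Measure (Fin d → ℝ) :=
  (D.hiddenLaw t).map fun z => D.M *ᵥ z

/-- The law of a positive pair `(x, x⁺) = (M z, M z⁺)` in task `t`. -/
def pairLaw (t : Fin T) : Measure ((Fin d → ℝ) × (Fin d → ℝ)) :=
  ((D.hiddenLaw t).prod (D.hiddenLaw t)).map
    fun q => (D.M *ᵥ q.1, D.M *ᵥ D.resample q.1 q.2)

/-- The label `y = (u*_t)ᵀ z_{R_t}` of task `t`. -/
def label (t : Fin T) (z : Fin d → ℝ) : ℝ :=
  ∑ j : {j : Fin d // j ∈ D.S ∪ D.P t}, D.ustar t j * z j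

/-- Task `t` as a distribution of pairs `(x, y)`. -/
def taskLaw (t : Fin T) : Measure ((Fin d → ℝ) × ℝ) :=
  (D.hiddenLaw t).map fun z => (D.M *ᵥ z, D.label t z)

/-- The population contrastive loss `E ℓ(φ(x)ᵀ (φ(x⁺) - E φ(x⁻)))` of `φ(x) = W x` on task `t`. -/
def contrastiveLoss {k : ℕ} (ℓ : ℝ → ℝ) (t : Fin T) (W : Matrix (Fin k) (Fin d) ℝ) : EReal :=
  expect (D.pairLaw t) fun p =>
    ℓ ((W *ᵥ p.1) ⬝ᵥ (W *ᵥ p.2 - ∫ x, W *ᵥ x ∂D.inputLaw t))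

/-- `W` is a representation obtained by pre-training on task `t` only: a minimizer of the
contrastive loss over the representation class. -/
def IsPretrained {k : ℕ} (ℓ : ℝ → ℝ) (t : Fin T) (W : Matrix (Fin k) (Fin d) ℝ) : Prop :=
  W ∈ repClass d k r ∧ IsMinOn (D.contrastiveLoss ℓ t) (repClass d k r) W

/-- The radii `B` for which some `u` with `‖u‖ ≤ B` satisfies `y = uᵀ φ(x)` on task `t`. -/
def realizingRadii {k : ℕ} (t : Fin T) (W : Matrix (Fin k) (Fin d) ℝ) : Set ℝ :=
  {B | ∃ u : EuclideanSpace ℝ (Fin k), ‖u‖ ≤ B ∧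
    ∀ᵐ p ∂D.taskLaw t, p.2 = u.ofLp ⬝ᵥ (W *ᵥ p.1)}

/-- The least realizing radius `B_{φ,t}`. -/
def radius {k : ℕ} (t : Fin T) (W : Matrix (Fin k) (Fin d) ℝ) : ℝ :=
  sInf (D.realizingRadii t W)

/-- The weights of the linear predictors in `F_{φ,t}`. -/
def predictors {k : ℕ} (t : Fin T) (W : Matrix (Fin k) (Fin d) ℝ) :
    Set (EuclideanSpace ℝ (Fin k)) :=
  {u | ‖u‖ ≤ D.radius t W}

/-- The risk `E_{(x,y) ∼ D_t} ℓc(uᵀ φ(x), y)` of the linear predictor `u` on `φ(x) = W x`. -/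
def risk {k : ℕ} (ℓc : ℝ → ℝ → ℝ) (t : Fin T) (W : Matrix (Fin k) (Fin d) ℝ)
    (u : EuclideanSpace ℝ (Fin k)) : EReal :=
  expect (D.taskLaw t) fun p => ℓc (u.ofLp ⬝ᵥ (W *ᵥ p.1)) p.2

/-- The risk `E_{D_t} ℓc(uᵀ z_S, y)` of a linear predictor on the shared features. -/
def sharedRisk (ℓc : ℝ → ℝ → ℝ) (t : Fin T) (u : {j : Fin d // j ∈ D.S} → ℝ) : EReal :=
  expect (D.hiddenLaw t) fun z => ℓc (∑ j : {j : Fin d // j ∈ D.S}, u j * z j) (D.label t z)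

/-- The empirical risk on a labeled sample. -/
def empiricalRisk {k m : ℕ} (ℓc : ℝ → ℝ → ℝ) (W : Matrix (Fin k) (Fin d) ℝ)
    (smp : Fin m → (Fin d → ℝ) × ℝ) (u : EuclideanSpace ℝ (Fin k)) : ℝ :=
  (1 / (m : ℝ)) * ∑ i, ℓc (u.ofLp ⬝ᵥ (W *ᵥ (smp i).1)) (smp i).2

/-- `u` is an empirical risk minimizer in `F_{φ,t}` for the given sample. -/
def IsERM {k m : ℕ} (ℓc : ℝ → ℝ → ℝ) (t : Fin T) (W : Matrix (Fin k) (Fin d) ℝ)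
    (smp : Fin m → (Fin d → ℝ) × ℝ) (u : EuclideanSpace ℝ (Fin k)) : Prop :=
  u ∈ D.predictors t W ∧ IsMinOn (empiricalRisk ℓc W smp) (D.predictors t W) u

end Model

end ContrastiveLinear

end

/-! The hidden law is symmetric, so the negative-sample mean vanishes and the loss is the mean of
`ℓ` at the similarity of a positive pair. Split `z` into invariant and spurious parts. Changing the
signs of the two independent spurious parts preserves the pair law, and averaging over the four sign
choices cancels every term of the similarity except the squared norm of the image of the invariant
part. Convexity (`similarity_average_le`), the contraction bound on `W` and monotonicity of `ℓ` then
bound the loss below by `minLoss`, which is attained when `W` is isometric on `R_t` and kills the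
other features (`SelectsFeatures`).

Conversely, a minimizer gives `ℓ(‖WMz‖²) = ℓ(‖z‖²)` almost surely, hence by continuity for every `z`
supported in `R_t`. Rescaling `z` towards the origin, where `ℓ` is strictly decreasing, forces
equality of the norms. The `r` unit columns over `R_t` exhaust the Frobenius budget, so the other
columns vanish. Thus `isPretrained_iff_selectsFeatures` holds, and completing the orthonormal
columns to a basis gives the rotation `Q`.

For such `W` the label weights, transported by `W M`, give a realizing predictor of norm `‖u*_t‖`,
and Cauchy–Schwarz shows that no smaller radius works. Its empirical risk is almost surely zero, so
the risk of any empirical minimizer is at most a uniform deviation over a ball. That deviation is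
controlled by symmetrization with contraction (`integral_iSup_centered_le`, `integral_iSup_sum_le`),
the second moment bound `E‖φ‖² ≤ r` and bounded differences; finite subfamilies of a dense sequence
avoid measurability problems for the full supremum.

On another task the private features of `t` vanish almost surely, so every predictor on `W` is there
a linear predictor on the shared features. -/

namespace ContrastiveLinear

/-! ### Suprema of finite families of functions -/

section Supremum

variable {ι : Type*} [Finite ι]

lemma le_iSup_of_finite (f : ι → ℝ) (i : ι) : f i ≤ ⨆ j, f j :=
  le_ciSup (Set.finite_range f).bddAbove i

lemma abs_iSup_le_of_finite [Nonempty ι] {f : ι → ℝ} {C : ℝ} (h : ∀ i, |f i| ≤ C) :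
    |⨆ i, f i| ≤ C := by
  obtain ⟨i, hi⟩ := exists_eq_ciSup_of_finite (f := f)
  rw [← hi]
  exact h i

lemma integrable_iSup_of_finite [Nonempty ι] {X : Type*} [MeasurableSpace X] {μ : Measure X}
    {f : ι → X → ℝ} (hm : ∀ i, Measurable (f i)) (hf : ∀ i, Integrable (f i) μ) :
    Integrable (fun x => ⨆ i, f i x) μ := by
  have := Fintype.ofFinite ι
  refine Integrable.mono' (g := fun x => ∑ i, |f i x|)
    (integrable_finsetSum _ fun i _ => (hf i).abs)
    (Measurable.iSup hm).aestronglyMeasurable (ae_of_all _ fun x => ?_)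
  rw [Real.norm_eq_abs]
  exact abs_iSup_le_of_finite fun i =>
    Finset.single_le_sum (f := fun i => |f i x|) (fun i _ => abs_nonneg _) (Finset.mem_univ i)

lemma iSup_integral_le_integral_iSup [Nonempty ι] {X : Type*} [MeasurableSpace X] {μ : Measure X}
    {f : ι → X → ℝ} (hm : ∀ i, Measurable (f i)) (hf : ∀ i, Integrable (f i) μ) :
    ⨆ i, ∫ x, f i x ∂μ ≤ ∫ x, ⨆ i, f i x ∂μ :=
  ciSup_le fun i => integral_mono (hf i) (integrable_iSup_of_finite hm hf)
    fun x => le_iSup_of_finite (fun i => f i x) i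

/-- The contraction step for a symmetric pair of suprema. -/
lemma iSup_add_iSup_le_of_abs_sub_le [Nonempty ι] {c a b : ι → ℝ}
    (h : ∀ i j, |a i - a j| ≤ |b i - b j|) :
    (⨆ i, (c i + a i)) + ⨆ i, (c i - a i) ≤ (⨆ i, (c i + b i)) + ⨆ i, (c i - b i) := by
  obtain ⟨i, hi⟩ := exists_eq_ciSup_of_finite (f := fun i => c i + a i)
  obtain ⟨j, hj⟩ := exists_eq_ciSup_of_finite (f := fun i => c i - a i)
  rw [← hi, ← hj]
  have h1 := le_iSup_of_finite (fun i => c i + b i) i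
  have h2 := le_iSup_of_finite (fun i => c i + b i) j
  have h3 := le_iSup_of_finite (fun i => c i - b i) i
  have h4 := le_iSup_of_finite (fun i => c i - b i) j
  have h5 := (le_abs_self _).trans (h i j)
  rcases abs_cases (b i - b j) with h6 | h6 <;> linarith

end Supremum

/-! ### Symmetrization and contraction without Rademacher signs -/

section Symmetrization

variable {X ι : Type*} [MeasurableSpace X] [Finite ι] [Nonempty ι] {μ : Measure X}
  [IsProbabilityMeasure μ]

/-- Symmetrization and contraction for one observation with a symmetric law. -/
lemma integral_iSup_centered_le {F T : ι → X → ℝ} (hFm : ∀ i, Measurable (F i))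
    (hF : ∀ i, Integrable (F i) μ) (hTm : ∀ i, Measurable (T i)) (hT : ∀ i, Integrable (T i) μ)
    (hFT : ∀ i j x, |F i x - F j x| ≤ |T i x - T j x|) {τ : X → X} (hτ : MeasurePreserving τ μ μ)
    (hTτ : ∀ i x, T i (τ x) = -T i x) (c : ι → ℝ) :
    ∫ x, ⨆ i, (c i + ((∫ y, F i y ∂μ) - F i x)) ∂μ ≤ ∫ x, ⨆ i, (c i + 2 * T i x) ∂μ := by
  have hc (i : ι) : Integrable (fun _ : X => c i) μ := integrable_const _
  have hF1 (i : ι) : Integrable (fun q : X × X => F i q.1) (μ.prod μ) := (hF i).comp_fst μ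
  have hF2 (i : ι) : Integrable (fun q : X × X => F i q.2) (μ.prod μ) := (hF i).comp_snd μ
  have iP : Integrable (fun x => ⨆ i, (c i + 2 * F i x)) μ :=
    integrable_iSup_of_finite (fun i => by have := hFm i; fun_prop)
      fun i => (hc i).add ((hF i).const_mul 2)
  have iN : Integrable (fun x => ⨆ i, (c i - 2 * F i x)) μ :=
    integrable_iSup_of_finite (fun i => by have := hFm i; fun_prop)
      fun i => (hc i).sub ((hF i).const_mul 2)
  have iTP : Integrable (fun x => ⨆ i, (c i + 2 * T i x)) μ :=
    integrable_iSup_of_finite (fun i => by have := hTm i; fun_prop)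
      fun i => (hc i).add ((hT i).const_mul 2)
  have iTN : Integrable (fun x => ⨆ i, (c i - 2 * T i x)) μ :=
    integrable_iSup_of_finite (fun i => by have := hTm i; fun_prop)
      fun i => (hc i).sub ((hT i).const_mul 2)
  have iD : Integrable (fun q : X × X => ⨆ i, (c i + (F i q.2 - F i q.1))) (μ.prod μ) :=
    integrable_iSup_of_finite (fun i => by have := hFm i; fun_prop)
      fun i => (integrable_const _).add ((hF2 i).sub (hF1 i))
  -- The mean is an average over an independent copy, and a supremum of averages is at most the
  -- average of the suprema.
  have ghost : ∫ x, ⨆ i, (c i + ((∫ y, F i y ∂μ) - F i x)) ∂μ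
      ≤ ∫ q, ⨆ i, (c i + (F i q.2 - F i q.1)) ∂(μ.prod μ) := by
    rw [integral_prod _ iD]
    refine integral_mono ?_ iD.integral_prod_left fun x => ?_
    · exact integrable_iSup_of_finite (fun i => by have := hFm i; fun_prop)
        fun i => (hc i).add ((integrable_const _).sub (hF i))
    · have key := iSup_integral_le_integral_iSup (μ := μ) (f := fun i y => c i + (F i y - F i x))
        (fun i => by have := hFm i; fun_prop)
        (fun i => (hc i).add ((hF i).sub (integrable_const _)))
      refine le_trans (le_of_eq ?_) key
      congr 1
      ext i
      rw [integral_add (hc i) (g := fun y => F i y - F i x) ((hF i).sub (integrable_const _)),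
        integral_sub (hF i) (integrable_const _)]
      simp
  -- Each expression is the half-sum of `c + 2F` at one point and `c - 2F` at the other. The two
  -- points then decouple, and both suprema can be taken at the same `x`, where the contraction step
  -- applies.
  have split : ∫ q, ⨆ i, (c i + (F i q.2 - F i q.1)) ∂(μ.prod μ)
      ≤ ∫ q : X × X, ((1 / 2) * (⨆ i, (c i + 2 * F i q.2)) + (1 / 2) * ⨆ i, (c i - 2 * F i q.1))
        ∂(μ.prod μ) := by
    refine integral_mono iD (((iP.comp_snd μ).const_mul _).add ((iN.comp_fst μ).const_mul _))
      fun q => ciSup_le fun i => ?_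
    have h1 := le_iSup_of_finite (fun i => c i + 2 * F i q.2) i
    have h2 := le_iSup_of_finite (fun i => c i - 2 * F i q.1) i
    simp only at h1 h2 ⊢
    linarith
  have eval : ∫ q : X × X, ((1 / 2) * (⨆ i, (c i + 2 * F i q.2))
        + (1 / 2) * ⨆ i, (c i - 2 * F i q.1)) ∂(μ.prod μ)
      = (1 / 2) * ∫ x, ((⨆ i, (c i + 2 * F i x)) + ⨆ i, (c i - 2 * F i x)) ∂μ := by
    rw [integral_add ((iP.comp_snd μ).const_mul _) ((iN.comp_fst μ).const_mul _),
      integral_const_mul, integral_const_mul, integral_add iP iN,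
      integral_fun_snd (f := fun x => ⨆ i, (c i + 2 * F i x)),
      integral_fun_fst (f := fun x => ⨆ i, (c i - 2 * F i x))]
    simp
    ring
  have contract : ∫ x, ((⨆ i, (c i + 2 * F i x)) + ⨆ i, (c i - 2 * F i x)) ∂μ
      ≤ ∫ x, ((⨆ i, (c i + 2 * T i x)) + ⨆ i, (c i - 2 * T i x)) ∂μ := by
    refine integral_mono (iP.add iN) (iTP.add iTN) fun x => ?_
    refine iSup_add_iSup_le_of_abs_sub_le fun i j => ?_
    rw [← mul_sub, ← mul_sub, abs_mul, abs_mul]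
    exact mul_le_mul_of_nonneg_left (hFT i j x) (abs_nonneg _)
  -- The symmetry `τ` plays the role of a random sign.
  have symm : ∫ x, ⨆ i, (c i - 2 * T i x) ∂μ = ∫ x, ⨆ i, (c i + 2 * T i x) ∂μ := by
    have h := integral_map (μ := μ) hτ.measurable.aemeasurable
      (f := fun x => ⨆ i, (c i + 2 * T i x)) (by rw [hτ.map_eq]; exact iTP.1)
    rw [hτ.map_eq] at h
    rw [h]
    simp only [hTτ]
    congr 1 with x
    congr 1 with i
    ring
  rw [integral_add iTP iTN, symm] at contract
  linarith

lemma integral_pi_succ {m : ℕ} (f : (Fin (m + 1) → X) → ℝ)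
    (hf : Integrable f (Measure.pi fun _ => μ)) :
    ∫ x, f x ∂(Measure.pi fun _ => μ)
      = ∫ a, ∫ y, f (Fin.cons a y) ∂(Measure.pi fun _ : Fin m => μ) ∂μ := by
  have h := (measurePreserving_piFinSuccAbove (fun _ : Fin (m + 1) => μ) 0).symm
  rw [← h.map_eq, integral_map_equiv, integral_prod]
  · simp [MeasurableEquiv.piFinSuccAbove_symm_apply, Fin.insertNthEquiv]
  · exact (h.integrable_comp_emb (MeasurableEquiv.measurableEmbedding _)).2 hf

/-- A comparison of suprema that holds for one observation tensorizes. -/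
lemma integral_iSup_sum_le {F G : ι → X → ℝ} (hFm : ∀ i, Measurable (F i))
    (hF : ∀ i, Integrable (F i) μ) (hGm : ∀ i, Measurable (G i)) (hG : ∀ i, Integrable (G i) μ)
    (h : ∀ c : ι → ℝ, ∫ x, ⨆ i, (c i + F i x) ∂μ ≤ ∫ x, ⨆ i, (c i + G i x) ∂μ)
    (m : ℕ) (c : ι → ℝ) :
    ∫ x, ⨆ i, (c i + ∑ a, F i (x a)) ∂(Measure.pi fun _ : Fin m => μ)
      ≤ ∫ x, ⨆ i, (c i + ∑ a, G i (x a)) ∂(Measure.pi fun _ : Fin m => μ) := by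
  have int_sum {H : ι → X → ℝ} (hH : ∀ i, Integrable (H i) μ) (m : ℕ) (i : ι) :
      Integrable (fun x : Fin m → X => ∑ a, H i (x a)) (Measure.pi fun _ => μ) :=
    integrable_finsetSum _ fun a _ => integrable_comp_eval (μ := fun _ : Fin m => μ) (hH i)
  have int_sup {H : ι → X → ℝ} (hHm : ∀ i, Measurable (H i)) (hH : ∀ i, Integrable (H i) μ)
      (m : ℕ) (c : ι → ℝ) : Integrable (fun x : Fin m → X => ⨆ i, (c i + ∑ a, H i (x a)))
        (Measure.pi fun _ => μ) :=
    integrable_iSup_of_finite (fun i => by have := hHm i; fun_prop)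
      fun i => (integrable_const _).add (int_sum hH m i)
  induction m generalizing c with
  | zero => simp
  | succ m ih =>
    rw [integral_pi_succ _ (int_sup hFm hF _ c), integral_pi_succ _ (int_sup hGm hG _ c)]
    simp only [Fin.sum_univ_succ, Fin.cons_zero, Fin.cons_succ, ← add_assoc]
    have int2 : Integrable (fun q : X × (Fin m → X) =>
        ⨆ i, (c i + F i q.1 + ∑ a, G i (q.2 a))) (μ.prod (Measure.pi fun _ => μ)) :=
      integrable_iSup_of_finite (fun i => by have := hFm i; have := hGm i; fun_prop)
        fun i => ((integrable_const _).add ((hF i).comp_fst _)).add ((int_sum hG m i).comp_snd _)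
    have int3 : Integrable (fun q : X × (Fin m → X) =>
        ⨆ i, (c i + F i q.1 + ∑ a, F i (q.2 a))) (μ.prod (Measure.pi fun _ => μ)) :=
      integrable_iSup_of_finite (fun i => by have := hFm i; fun_prop)
        fun i => ((integrable_const _).add ((hF i).comp_fst _)).add ((int_sum hF m i).comp_snd _)
    have int4 : Integrable (fun q : X × (Fin m → X) =>
        ⨆ i, (c i + G i q.1 + ∑ a, G i (q.2 a))) (μ.prod (Measure.pi fun _ => μ)) :=
      integrable_iSup_of_finite (fun i => by have := hGm i; fun_prop)
        fun i => ((integrable_const _).add ((hG i).comp_fst _)).add ((int_sum hG m i).comp_snd _)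
    -- The offset `c` is arbitrary so that it can absorb observations: here the first one, and after
    -- Fubini all the others.
    refine (integral_mono int3.integral_prod_left int2.integral_prod_left
      fun x => ih fun i => c i + F i x).trans ?_
    rw [integral_integral_swap
        (f := fun (x : X) (y : Fin m → X) => ⨆ i, (c i + F i x + ∑ a, G i (y a))) int2,
      integral_integral_swap
        (f := fun (x : X) (y : Fin m → X) => ⨆ i, (c i + G i x + ∑ a, G i (y a))) int4]
    refine integral_mono int2.integral_prod_right int4.integral_prod_right fun y => ?_
    have := h fun i => c i + ∑ a, G i (y a)
    simpa only [add_right_comm] using this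

end Symmetrization

/-! ### A bounded differences inequality -/

section BoundedDifferences

variable {X : Type*} [MeasurableSpace X] {μ : Measure X} [IsProbabilityMeasure μ]

lemma integrable_of_measurable_of_abs_le {Y : Type*} [MeasurableSpace Y] {ν : Measure Y}
    [IsFiniteMeasure ν] {f : Y → ℝ} (hf : Measurable f) {C : ℝ} (hC : ∀ x, |f x| ≤ C) :
    Integrable f ν :=
  Integrable.of_bound hf.aestronglyMeasurable C (ae_of_all _ hC)

/-- The exponential moment bound behind the bounded differences inequality. -/
lemma integral_exp_le_of_bounded_differences {c : ℝ} (m : ℕ)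
    {f : (Fin m → X) → ℝ} (hf : Measurable f) {C : ℝ} (hC : ∀ x, |f x| ≤ C)
    (hc : ∀ x i a, |f (Function.update x i a) - f x| ≤ c) (s : ℝ) :
    ∫ x, Real.exp (s * f x) ∂(Measure.pi fun _ => μ)
      ≤ Real.exp (s * (∫ x, f x ∂(Measure.pi fun _ => μ)) + m * c ^ 2 * s ^ 2 / 2) := by
  have int_exp {Y : Type _} [MeasurableSpace Y] {ν : Measure Y} [IsProbabilityMeasure ν]
      {g : Y → ℝ} (hg : Measurable g) (hgC : ∀ y, |g y| ≤ C) :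
      Integrable (fun y => Real.exp (s * g y)) ν := by
    refine integrable_of_measurable_of_abs_le (C := Real.exp (|s| * C)) (by fun_prop) fun y => ?_
    rw [abs_of_pos (Real.exp_pos _), Real.exp_le_exp]
    refine (le_abs_self _).trans ?_
    rw [abs_mul]
    exact mul_le_mul_of_nonneg_left (hgC y) (abs_nonneg _)
  induction m with
  | zero =>
    have hconst : f = fun _ => f default := funext fun x => congrArg f (Subsingleton.elim _ _)
    rw [hconst]
    simp
  | succ m ih =>
    obtain ⟨a₀⟩ : Nonempty X := nonempty_of_isProbabilityMeasure μ
    set ν : Measure (Fin m → X) := Measure.pi fun _ => μ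
    have hcons : Measurable fun q : X × (Fin m → X) => (Fin.cons q.1 q.2 : Fin (m + 1) → X) := by
      refine measurable_pi_lambda _ fun i => ?_
      refine Fin.cases ?_ (fun j => ?_) i
      · simpa using measurable_fst
      · simpa only [Fin.cons_succ, Function.comp_def] using
          (measurable_pi_apply j).comp measurable_snd
    have hf2 : Measurable fun q : X × (Fin m → X) => f (Fin.cons q.1 q.2) := hf.comp hcons
    have hfa (a : X) : Measurable fun y : Fin m → X => f (Fin.cons a y) :=
      hf2.comp measurable_prodMk_left
    -- The conditional mean given the first observation: the induction hypothesis treats the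
    -- fluctuation around it, Hoeffding's lemma its own fluctuation.
    set g : X → ℝ := fun a => ∫ y, f (Fin.cons a y) ∂ν with hg
    have hgm : Measurable g := hf2.stronglyMeasurable.integral_prod_right'.measurable
    have hgC (a : X) : |g a| ≤ C := by
      have h := norm_integral_le_of_norm_le_const (μ := ν) (f := fun y => f (Fin.cons a y))
        (C := C) (ae_of_all _ fun y => hC _)
      simpa using h
    have hgdiff (a b : X) : |g a - g b| ≤ c := by
      rw [hg]
      simp only
      rw [← integral_sub (integrable_of_measurable_of_abs_le (hfa a) fun y => hC _)
        (integrable_of_measurable_of_abs_le (hfa b) fun y => hC _)]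
      have h := norm_integral_le_of_norm_le_const (μ := ν)
        (f := fun y => f (Fin.cons a y) - f (Fin.cons b y)) (C := c) (ae_of_all _ fun y => by
          have := hc (Fin.cons b y) 0 a
          rwa [Fin.update_cons_zero] at this)
      simpa using h
    -- The interval of radius `c` around `g a₀` has length `2c`, so the variance proxy is `c²`
    -- instead of the optimal `c² / 4`.
    have hoeff : ∫ a, Real.exp (s * g a) ∂μ ≤ Real.exp (s * (∫ a, g a ∂μ) + c ^ 2 * s ^ 2 / 2) := by
      have h := (hasSubgaussianMGF_of_mem_Icc (μ := μ) (X := g) (a := g a₀ - c) (b := g a₀ + c)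
        hgm.aemeasurable (ae_of_all _ fun a => by
          have := abs_le.1 (hgdiff a a₀); constructor <;> linarith)).mgf_le s
      have e1 : (((‖g a₀ + c - (g a₀ - c)‖₊ / 2) ^ 2 : ℝ≥0) : ℝ) = c ^ 2 := by
        simp only [NNReal.coe_pow, NNReal.coe_div, coe_nnnorm, NNReal.coe_ofNat, Real.norm_eq_abs]
        rw [div_pow, sq_abs]
        ring
      rw [e1, mgf] at h
      simp only [mul_sub, Real.exp_sub, integral_div] at h
      rw [div_le_iff₀ (Real.exp_pos _), ← Real.exp_add] at h
      rwa [add_comm]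
    have inner (a : X) : ∫ y, Real.exp (s * f (Fin.cons a y)) ∂ν
        ≤ Real.exp (m * c ^ 2 * s ^ 2 / 2) * Real.exp (s * g a) := by
      rw [← Real.exp_add, add_comm (m * c ^ 2 * s ^ 2 / 2)]
      refine ih (hfa a) (fun y => hC _) fun y i b => ?_
      have := hc (Fin.cons a y) i.succ b
      rwa [← Fin.cons_update] at this
    have hint : Integrable (fun q : X × (Fin m → X) => Real.exp (s * f (Fin.cons q.1 q.2)))
        (μ.prod ν) := int_exp hf2 fun q => hC _
    rw [integral_pi_succ _ (int_exp hf hC),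
      integral_pi_succ _ (integrable_of_measurable_of_abs_le hf hC)]
    calc ∫ a, ∫ y, Real.exp (s * f (Fin.cons a y)) ∂ν ∂μ
        ≤ ∫ a, Real.exp (m * c ^ 2 * s ^ 2 / 2) * Real.exp (s * g a) ∂μ :=
          integral_mono hint.integral_prod_left ((int_exp hgm hgC).const_mul _) inner
      _ ≤ Real.exp (m * c ^ 2 * s ^ 2 / 2) * Real.exp (s * (∫ a, g a ∂μ) + c ^ 2 * s ^ 2 / 2) := by
          rw [integral_const_mul]
          exact mul_le_mul_of_nonneg_left hoeff (Real.exp_pos _).le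
      _ = _ := by
          rw [← Real.exp_add]
          congr 1
          push_cast
          ring

/-- A bounded differences inequality (with a constant that is not optimal). -/
lemma measureReal_ge_le_of_bounded_differences {c : ℝ} {m : ℕ}
    {f : (Fin m → X) → ℝ} (hf : Measurable f) {C : ℝ} (hC : ∀ x, |f x| ≤ C)
    (hc : ∀ x i a, |f (Function.update x i a) - f x| ≤ c) (hmc : 0 < m * c ^ 2)
    {ε : ℝ} (hε : 0 ≤ ε) :
    (Measure.pi fun _ : Fin m => μ).real {x | (∫ y, f y ∂(Measure.pi fun _ => μ)) + ε ≤ f x}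
      ≤ Real.exp (-ε ^ 2 / (2 * (m * c ^ 2))) := by
  set ν := Measure.pi fun _ : Fin m => μ
  set E := ∫ y, f y ∂ν
  -- The minimizer of the Chernoff exponent `-s ε + m c² s² / 2`.
  set s : ℝ := ε / (m * c ^ 2) with hs
  have hs0 : 0 ≤ s := by positivity
  have hint : Integrable (fun y => Real.exp (s * f y)) ν := by
    refine integrable_of_measurable_of_abs_le (C := Real.exp (|s| * C)) (by fun_prop) fun y => ?_
    rw [abs_of_pos (Real.exp_pos _), Real.exp_le_exp]
    refine (le_abs_self _).trans ?_
    rw [abs_mul]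
    exact mul_le_mul_of_nonneg_left (hC y) (abs_nonneg _)
  have h1 := measure_ge_le_exp_mul_mgf (μ := ν) (X := f) (E + ε) hs0 hint
  refine h1.trans ?_
  have h2 := integral_exp_le_of_bounded_differences (μ := μ) m hf hC hc s
  refine (mul_le_mul_of_nonneg_left h2 (Real.exp_pos _).le).trans ?_
  rw [← Real.exp_add, Real.exp_le_exp]
  apply le_of_eq
  change -s * (E + ε) + (s * E + m * c ^ 2 * s ^ 2 / 2) = _
  rw [hs]
  field_simp
  ring

end BoundedDifferences

/-! ### Expectations with values in the extended reals -/

section Expectation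

variable {Ω Ω' : Type*} [MeasurableSpace Ω] [MeasurableSpace Ω'] {μ : Measure Ω}

lemma expect_map {g : Ω → Ω'} (hg : Measurable g) {f : Ω' → ℝ} (hf : Measurable f) :
    expect (μ.map g) f = expect μ fun ω => f (g ω) := by
  unfold expect
  rw [lintegral_map (by fun_prop) hg, lintegral_map (by fun_prop) hg]

lemma expect_congr_ae {f g : Ω → ℝ} (h : f =ᵐ[μ] g) : expect μ f = expect μ g := by
  unfold expect
  congr 2
  · exact lintegral_congr_ae (h.mono fun ω hω => by simp only [hω])
  · exact lintegral_congr_ae (h.mono fun ω hω => by simp only [hω])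

lemma expect_eq_integral {f : Ω → ℝ} (hf : Integrable f μ) :
    expect μ f = ((∫ ω, f ω ∂μ : ℝ) : EReal) := by
  have h1 : ∫⁻ ω, ENNReal.ofReal (f ω) ∂μ ≠ ∞ := hf.lintegral_lt_top.ne
  have h2 : ∫⁻ ω, ENNReal.ofReal (-f ω) ∂μ ≠ ∞ := hf.neg.lintegral_lt_top.ne
  unfold expect
  rw [integral_eq_lintegral_pos_part_sub_lintegral_neg_part hf, EReal.coe_sub,
    EReal.coe_ennreal_toReal h1, EReal.coe_ennreal_toReal h2]

/-- A random variable with an integrable lower bound is integrable or has expectation `+∞`. -/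
lemma integrable_or_expect_eq_top {f h : Ω → ℝ} (hf : Measurable f) (hh : Integrable h μ)
    (hle : ∀ ω, h ω ≤ f ω) : Integrable f μ ∨ expect μ f = ⊤ := by
  have h2 : ∫⁻ ω, ENNReal.ofReal (-f ω) ∂μ ≠ ∞ := by
    refine ne_top_of_le_ne_top hh.neg.lintegral_lt_top.ne (lintegral_mono fun ω => ?_)
    exact ENNReal.ofReal_le_ofReal (neg_le_neg (hle ω))
  by_cases h1 : ∫⁻ ω, ENNReal.ofReal (f ω) ∂μ = ∞
  · right
    unfold expect
    rw [h1, ← EReal.coe_ennreal_toReal h2]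
    simp
  · left
    refine ⟨hf.aestronglyMeasurable, ?_⟩
    rw [hasFiniteIntegral_iff_norm]
    have : ∀ ω, ENNReal.ofReal ‖f ω‖ = ENNReal.ofReal (f ω) + ENNReal.ofReal (-f ω) := by
      intro ω
      rcases le_total 0 (f ω) with h0 | h0
      · rw [Real.norm_of_nonneg h0, ENNReal.ofReal_of_nonpos (neg_nonpos.2 h0), add_zero]
      · rw [Real.norm_of_nonpos h0, ENNReal.ofReal_of_nonpos h0, zero_add]
    simp only [this]
    rw [lintegral_add_left (by fun_prop)]
    exact ENNReal.add_lt_top.2 ⟨lt_top_iff_ne_top.2 h1, lt_top_iff_ne_top.2 h2⟩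

end Expectation

/-! ### Convex nonincreasing losses -/

section ConvexLoss

variable {ℓ : ℝ → ℝ}

lemma convex_continuous (hconv : ConvexOn ℝ Set.univ ℓ) : Continuous ℓ :=
  continuousOn_univ.1 (hconv.continuousOn isOpen_univ)

/-- To the right of `0`, a convex function lies above its chord through `-1` and `0`; to the left,
monotonicity suffices. This linear lower bound keeps the negative part of the loss integrable. -/
lemma sub_mul_abs_le_of_convex_antitone (hconv : ConvexOn ℝ Set.univ ℓ) (hdecr : Antitone ℓ)
    (x : ℝ) : ℓ 0 - (ℓ (-1) - ℓ 0) * |x| ≤ ℓ x := by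
  have hC : ℓ 0 ≤ ℓ (-1) := hdecr (by norm_num)
  rcases le_total x 0 with hx | hx
  · have := hdecr hx
    have := mul_nonneg (sub_nonneg.2 hC) (abs_nonneg x)
    linarith
  · rw [abs_of_nonneg hx]
    have h1 : (0 : ℝ) < 1 + x := by linarith
    have h := hconv.2 (Set.mem_univ (-1)) (Set.mem_univ x)
      (show 0 ≤ x / (1 + x) by positivity) (show 0 ≤ 1 / (1 + x) by positivity)
      (by field_simp; ring)
    have e : (x / (1 + x)) • (-1 : ℝ) + (1 / (1 + x)) • x = 0 := by
      simp only [smul_eq_mul]; field_simp; ring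
    rw [e] at h
    simp only [smul_eq_mul] at h
    have h2 := mul_le_mul_of_nonneg_left h h1.le
    have h3 : (1 + x) * (x / (1 + x) * ℓ (-1) + 1 / (1 + x) * ℓ x) = x * ℓ (-1) + ℓ x := by
      field_simp
    rw [h3] at h2
    linarith

lemma four_point_convexity (hconv : ConvexOn ℝ Set.univ ℓ) (a b c d : ℝ) :
    ℓ ((a + b + c + d) / 4) ≤ (ℓ a + ℓ b + ℓ c + ℓ d) / 4 := by
  have mid (x y : ℝ) : ℓ ((x + y) / 2) ≤ (ℓ x + ℓ y) / 2 := by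
    have h := hconv.2 (Set.mem_univ x) (Set.mem_univ y)
      (show (0 : ℝ) ≤ 1 / 2 by norm_num) (show (0 : ℝ) ≤ 1 / 2 by norm_num) (by norm_num)
    simp only [smul_eq_mul] at h
    rw [show (x + y) / 2 = 1 / 2 * x + 1 / 2 * y by ring]
    linarith
  have h := mid ((a + b) / 2) ((c + d) / 2)
  have h1 := mid a b
  have h2 := mid c d
  rw [show (a + b + c + d) / 4 = ((a + b) / 2 + (c + d) / 2) / 2 by ring]
  linarith

/-- The loss separates rays from the origin. -/
lemma eq_of_forall_pos_convex_apply_mul_eq (hconv : ConvexOn ℝ Set.univ ℓ)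
    (hstrict : ∃ a : ℝ, 0 < a ∧ ℓ a < ℓ 0) {a b : ℝ} (hab : a ≤ b)
    (h : ∀ c : ℝ, 0 < c → ℓ (c * a) = ℓ (c * b)) : a = b := by
  by_contra hne
  have hlt : a < b := lt_of_le_of_ne hab hne
  obtain ⟨x, hx, hℓx⟩ := hstrict
  have hc : Continuous fun c : ℝ => ℓ (c * b) := (convex_continuous hconv).comp (by fun_prop)
  have e1 : ∀ᶠ c in nhds (0 : ℝ), ℓ x < ℓ (c * b) :=
    hc.continuousAt.eventually (lt_mem_nhds (by simpa using hℓx))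
  have e2 : ∀ᶠ c in nhds (0 : ℝ), c * b < x :=
    (show Continuous fun c : ℝ => c * b by fun_prop).continuousAt.eventually
      (gt_mem_nhds (by simpa using hx))
  -- For small `c > 0` the point `c b` lies left of `x` and still has a larger loss. If `ℓ` agreed
  -- at `c a < c b`, the zero slope there would force a nonnegative slope from `c b` to `x`.
  obtain ⟨c, ⟨h1, h2⟩, h3 : 0 < c⟩ :=
    (((e1.and e2).filter_mono nhdsWithin_le_nhds).and
      (self_mem_nhdsWithin : Set.Ioi (0 : ℝ) ∈ nhdsWithin 0 (Set.Ioi 0))).exists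
  have hs := hconv.slope_mono_adjacent (Set.mem_univ (c * a)) (Set.mem_univ x)
    (mul_lt_mul_of_pos_left hlt h3) h2
  rw [h c h3, sub_self, zero_div] at hs
  have := (div_nonneg_iff.1 hs)
  rcases this with h4 | h4 <;> linarith [h4.1, h4.2]

end ConvexLoss

/-! ### The hidden law: symmetries, support and moments -/

namespace Model

variable {d T s r k : ℕ} (D : Model d T s r) (t : Fin T)

lemma card_Rt : (D.Rt t).card = r := by
  have h := D.s_le_r
  rw [Rt, Finset.card_union_of_disjoint (D.disjoint_P_S t).symm, D.card_S, D.card_P]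
  omega

lemma Rt_subset_R : D.Rt t ⊆ D.R := Finset.subset_biUnion_of_mem D.Rt (Finset.mem_univ t)

lemma hiddenLaw_eq : D.hiddenLaw t = Measure.pi fun j =>
    if j ∈ D.R ∧ j ∉ D.Rt t then Measure.dirac 0 else gaussianReal 0 1 := rfl

instance featureLaw_isProbabilityMeasure (j : Fin d) : IsProbabilityMeasure
    (if j ∈ D.R ∧ j ∉ D.Rt t then Measure.dirac (0 : ℝ) else gaussianReal 0 1) := by
  split_ifs <;> infer_instance

instance hiddenLaw_isProbabilityMeasure : IsProbabilityMeasure (D.hiddenLaw t) := by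
  rw [hiddenLaw_eq]; infer_instance

/-- Sets the features outside task `t` to zero. -/
def mask (z : Fin d → ℝ) : Fin d → ℝ := fun j => if j ∈ D.R ∧ j ∉ D.Rt t then 0 else z j

/-- Realizing the degenerate hidden law as an image of a nondegenerate Gaussian makes the full
support of the latter available. -/
lemma measurePreserving_mask :
    MeasurePreserving (D.mask t) (Measure.pi fun _ => gaussianReal 0 1) (D.hiddenLaw t) := by
  refine measurePreserving_pi (fun _ => gaussianReal 0 1) _ (f := fun j x =>
    if j ∈ D.R ∧ j ∉ D.Rt t then 0 else x) fun j => ?_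
  by_cases h : j ∈ D.R ∧ j ∉ D.Rt t
  · simp only [h, if_true, not_false_eq_true, and_self]
    exact ⟨measurable_const, by simp⟩
  · simp only [h, if_false]
    exact MeasurePreserving.id _

lemma measurePreserving_neg_gaussianReal :
    MeasurePreserving (fun x : ℝ => -x) (gaussianReal 0 1) (gaussianReal 0 1) :=
  ⟨measurable_neg, by rw [gaussianReal_map_neg, neg_zero]⟩

/-- Changing the signs of some features preserves the law. -/
lemma measurePreserving_signs (p : Fin d → Prop) [DecidablePred p] :
    MeasurePreserving (fun z j => if p j then z j else -z j) (D.hiddenLaw t) (D.hiddenLaw t) := by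
  refine measurePreserving_pi _ _ (f := fun j x => if p j then x else -x) fun j => ?_
  by_cases hp : p j
  · simp only [hp, if_true]
    exact MeasurePreserving.id _
  · simp only [hp, if_false]
    by_cases h : j ∈ D.R ∧ j ∉ D.Rt t
    · simp only [h, if_true, not_false_eq_true, and_self]
      exact ⟨measurable_neg, by simp [Measure.map_dirac]⟩
    · simp only [h, if_false]
      exact measurePreserving_neg_gaussianReal

lemma measurePreserving_neg :
    MeasurePreserving (fun z : Fin d → ℝ => -z) (D.hiddenLaw t) (D.hiddenLaw t) := by
  have h := D.measurePreserving_signs t fun _ => False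
  simp only [if_false] at h
  exact h

lemma ae_eq_zero_of_notMem : ∀ᵐ z ∂D.hiddenLaw t, ∀ j, j ∈ D.R → j ∉ D.Rt t → z j = 0 := by
  rw [← (D.measurePreserving_mask t).map_eq]
  have hm : MeasurableSet {z : Fin d → ℝ | ∀ j, j ∈ D.R → j ∉ D.Rt t → z j = 0} := by
    simp only [Set.ofPred_forall]
    refine MeasurableSet.iInter fun j => MeasurableSet.iInter fun _ =>
      MeasurableSet.iInter fun _ => ?_
    exact measurableSet_eq_fun (measurable_pi_apply j) measurable_const
  rw [ae_map_iff (D.measurePreserving_mask t).measurable.aemeasurable hm]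
  exact ae_of_all _ fun z j h1 h2 => by simp [mask, h1, h2]

lemma isOpenPosMeasure_gaussian :
    (Measure.pi fun _ : Fin d => gaussianReal 0 1).IsOpenPosMeasure := by
  have : (gaussianReal 0 1).IsOpenPosMeasure :=
    (gaussianReal_absolutelyContinuous' 0 one_ne_zero).isOpenPosMeasure
  infer_instance

/-- Continuous functions that agree almost surely agree on all vectors without features of other
tasks. -/
lemma eq_of_ae_eq {f g : (Fin d → ℝ) → ℝ} (hf : Continuous f) (hg : Continuous g)
    (h : f =ᵐ[D.hiddenLaw t] g) {z : Fin d → ℝ} (hz : ∀ j, j ∈ D.R → j ∉ D.Rt t → z j = 0) :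
    f z = g z := by
  have := isOpenPosMeasure_gaussian (d := d)
  have hmask : Continuous (D.mask t) := by
    refine continuous_pi fun j => ?_
    unfold mask
    split_ifs <;> fun_prop
  -- After composition with the mask the equality holds almost everywhere for a measure of full
  -- support, hence everywhere; `z` is fixed by the mask.
  have h' := (D.measurePreserving_mask t).quasiMeasurePreserving.ae_eq_comp h
  have h2 := congrFun (((hf.comp hmask).ae_eq_iff_eq _ (hg.comp hmask)).1 h') z
  have hzz : D.mask t z = z := by
    ext j
    unfold mask
    split_ifs with hj
    · exact (hz j hj.1 hj.2).symm
    · rfl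
  simpa [hzz] using h2

lemma memLp_feature (j : Fin d) : MemLp (fun z : Fin d → ℝ => z j) 2 (D.hiddenLaw t) := by
  have h : MemLp (fun x : ℝ => x) 2
      (if j ∈ D.R ∧ j ∉ D.Rt t then Measure.dirac (0 : ℝ) else gaussianReal 0 1) := by
    split_ifs
    · exact (memLp_const (0 : ℝ)).ae_eq (by rw [Filter.EventuallyEq, ae_dirac_eq]; simp)
    · exact memLp_id_gaussianReal' 2 (by simp)
  exact h.comp_measurePreserving (measurePreserving_eval _ j)

/-- The law is invariant under `z ↦ -z`. Applied to `φ`, this removes the negative-sample mean from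
the loss. -/
lemma integral_of_odd {E : Type*} [NormedAddCommGroup E] [NormedSpace ℝ E]
    {f : (Fin d → ℝ) → E} (hf : ∀ z, f (-z) = -f z) : ∫ z, f z ∂D.hiddenLaw t = 0 := by
  have h := (D.measurePreserving_neg t).integral_comp (MeasurableEquiv.neg _).measurableEmbedding f
  simp only [hf, integral_neg] at h
  have h2 : (2 : ℝ) • ∫ z, f z ∂D.hiddenLaw t = 0 := by
    rw [two_smul]
    nth_rewrite 1 [← h]
    exact neg_add_cancel _
  exact (smul_eq_zero.1 h2).resolve_left two_ne_zero

end Model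

/-! ### Spectral and Frobenius norms in terms of dot products -/

lemma dotProduct_eq_norm_sq {n : ℕ} (v : Fin n → ℝ) : v ⬝ᵥ v = ‖WithLp.toLp 2 v‖ ^ 2 := by
  rw [EuclideanSpace.real_norm_sq_eq]
  simp [dotProduct, sq]

lemma dotProduct_le_norm_mul_norm {n : ℕ} (v w : Fin n → ℝ) :
    v ⬝ᵥ w ≤ ‖WithLp.toLp 2 v‖ * ‖WithLp.toLp 2 w‖ := by
  have h := real_inner_le_norm (WithLp.toLp 2 v) (WithLp.toLp 2 w)
  simpa [PiLp.inner_apply, dotProduct, mul_comm] using h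

lemma opNorm_le_one_iff {k d : ℕ} (W : Matrix (Fin k) (Fin d) ℝ) :
    ‖(Matrix.toEuclideanLin W).toContinuousLinearMap‖ ≤ 1 ↔
      ∀ v, (W *ᵥ v) ⬝ᵥ (W *ᵥ v) ≤ v ⬝ᵥ v := by
  simp only [dotProduct_eq_norm_sq, sq_le_sq₀ (norm_nonneg _) (norm_nonneg _)]
  constructor
  · intro h v
    have := (Matrix.toEuclideanLin W).toContinuousLinearMap.le_of_opNorm_le h (WithLp.toLp 2 v)
    simpa using this
  · intro h
    refine ContinuousLinearMap.opNorm_le_bound _ zero_le_one fun x => ?_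
    rw [one_mul]
    exact h x.ofLp

lemma mul_transpose_self_of_mem {n : ℕ} {Q : Matrix (Fin n) (Fin n) ℝ}
    (hQ : Q ∈ Matrix.orthogonalGroup (Fin n) ℝ) : Qᵀ * Q = 1 :=
  (Matrix.mem_orthogonalGroup_iff' _ _).1 hQ

lemma dotProduct_mulVec_mulVec {m n : ℕ} (A : Matrix (Fin m) (Fin n) ℝ) (v w : Fin n → ℝ) :
    (A *ᵥ v) ⬝ᵥ (A *ᵥ w) = v ⬝ᵥ ((Aᵀ * A) *ᵥ w) := by
  rw [← Matrix.mulVec_mulVec, Matrix.dotProduct_mulVec v, Matrix.vecMul_transpose]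

lemma dotProduct_mulVec_orthogonal {n : ℕ} {Q : Matrix (Fin n) (Fin n) ℝ}
    (hQ : Q ∈ Matrix.orthogonalGroup (Fin n) ℝ) (v w : Fin n → ℝ) :
    (Q *ᵥ v) ⬝ᵥ (Q *ᵥ w) = v ⬝ᵥ w := by
  rw [dotProduct_mulVec_mulVec, mul_transpose_self_of_mem hQ, Matrix.one_mulVec]

lemma sum_sq_eq_trace {k d : ℕ} (W : Matrix (Fin k) (Fin d) ℝ) :
    ∑ i, ∑ j, W i j ^ 2 = (Wᵀ * W).trace := by
  rw [Finset.sum_comm]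
  simp [Matrix.trace, Matrix.mul_apply, sq]

lemma sum_sq_mul_orthogonal {k d : ℕ} (W : Matrix (Fin k) (Fin d) ℝ)
    {M : Matrix (Fin d) (Fin d) ℝ} (hM : M ∈ Matrix.orthogonalGroup (Fin d) ℝ) :
    ∑ i, ∑ j, (W * M) i j ^ 2 = ∑ i, ∑ j, W i j ^ 2 := by
  have h : M * Mᵀ = 1 := (Matrix.mem_orthogonalGroup_iff _ _).1 hM
  rw [sum_sq_eq_trace, sum_sq_eq_trace, Matrix.transpose_mul, Matrix.mul_assoc,
    Matrix.trace_mul_comm, Matrix.mul_assoc, Matrix.mul_assoc, h, Matrix.mul_one]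

/-- The squared Frobenius norm as a sum over the columns. -/
lemma sum_sq_eq_sum_columns {k d : ℕ} (A : Matrix (Fin k) (Fin d) ℝ) :
    ∑ i, ∑ j, A i j ^ 2
      = ∑ j, (A *ᵥ Pi.single j 1) ⬝ᵥ (A *ᵥ Pi.single j 1) := by
  rw [Finset.sum_comm]
  simp [dotProduct, sq]

/-! ### Representations that select the features of a task -/

namespace Model

variable {d T s r k : ℕ} (D : Model d T s r) (t : Fin T)

/-- The representation is an isometry on the features of task `t` and ignores the others. -/
def SelectsFeatures (W : Matrix (Fin k) (Fin d) ℝ) : Prop :=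
  ∀ z w : Fin d → ℝ, (W *ᵥ (D.M *ᵥ z)) ⬝ᵥ (W *ᵥ (D.M *ᵥ w)) = ∑ j ∈ D.Rt t, z j * w j

lemma mulVec_dotProduct_self_le {W : Matrix (Fin k) (Fin d) ℝ} (hW : W ∈ repClass d k r)
    (z : Fin d → ℝ) : (W *ᵥ (D.M *ᵥ z)) ⬝ᵥ (W *ᵥ (D.M *ᵥ z)) ≤ z ⬝ᵥ z :=
  ((opNorm_le_one_iff W).1 hW.1 _).trans_eq (dotProduct_mulVec_orthogonal D.M_mem z z)

lemma sum_columns_le {W : Matrix (Fin k) (Fin d) ℝ} (hW : W ∈ repClass d k r) :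
    ∑ j, (W *ᵥ (D.M *ᵥ Pi.single j 1)) ⬝ᵥ (W *ᵥ (D.M *ᵥ Pi.single j 1)) ≤ (r : ℝ) := by
  have h := (Real.sqrt_le_sqrt_iff (Nat.cast_nonneg r)).1 hW.2
  rw [← sum_sq_mul_orthogonal W D.M_mem, sum_sq_eq_sum_columns] at h
  simpa only [Matrix.mulVec_mulVec] using h

variable {D t}

lemma SelectsFeatures.mem_repClass {W : Matrix (Fin k) (Fin d) ℝ} (h : D.SelectsFeatures t W) :
    W ∈ repClass d k r := by
  constructor
  · rw [opNorm_le_one_iff]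
    intro v
    have hM : D.M * D.Mᵀ = 1 := (Matrix.mem_orthogonalGroup_iff _ _).1 D.M_mem
    have hv : v = D.M *ᵥ (D.Mᵀ *ᵥ v) := by rw [Matrix.mulVec_mulVec, hM, Matrix.one_mulVec]
    rw [hv, h, dotProduct_mulVec_orthogonal D.M_mem]
    exact Finset.sum_le_univ_sum_of_nonneg fun j => mul_self_nonneg _
  · refine Real.sqrt_le_sqrt (le_of_eq ?_)
    rw [← sum_sq_mul_orthogonal W D.M_mem, sum_sq_eq_sum_columns]
    simp only [← Matrix.mulVec_mulVec, h _ _, Pi.single_apply]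
    rw [Finset.sum_comm]
    simp [card_Rt]

/-- The columns of `W M` over `R_t` have norm one and there are `r` of them, so the Frobenius bound
leaves nothing for the other columns. Polarization turns preserved norms into preserved inner
products. -/
lemma selectsFeatures_of_isometry {W : Matrix (Fin k) (Fin d) ℝ} (hW : W ∈ repClass d k r)
    (h : ∀ z : Fin d → ℝ, (∀ j, j ∉ D.Rt t → z j = 0) →
      (W *ᵥ (D.M *ᵥ z)) ⬝ᵥ (W *ᵥ (D.M *ᵥ z)) = z ⬝ᵥ z) : D.SelectsFeatures t W := by
  have hcol (j : Fin d) (hj : j ∉ D.Rt t) : W *ᵥ (D.M *ᵥ Pi.single j 1) = 0 := by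
    have h1 := D.sum_columns_le hW
    rw [← Finset.sum_add_sum_compl (D.Rt t)] at h1
    have h2 : ∑ j ∈ D.Rt t, (W *ᵥ (D.M *ᵥ Pi.single j 1)) ⬝ᵥ (W *ᵥ (D.M *ᵥ Pi.single j 1))
        = (r : ℝ) := by
      rw [Finset.sum_congr rfl (g := fun _ => (1 : ℝ))]
      · simp [card_Rt]
      · intro i hi
        rw [h _ fun l hl => by
          rw [Pi.single_apply, if_neg]; rintro rfl; exact hl hi]
        simp
    have h3 : (W *ᵥ (D.M *ᵥ Pi.single j 1)) ⬝ᵥ (W *ᵥ (D.M *ᵥ Pi.single j 1))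
        ≤ ∑ j ∈ (D.Rt t)ᶜ, (W *ᵥ (D.M *ᵥ Pi.single j 1)) ⬝ᵥ (W *ᵥ (D.M *ᵥ Pi.single j 1)) :=
      Finset.single_le_sum (f := fun j => (W *ᵥ (D.M *ᵥ Pi.single j 1)) ⬝ᵥ
        (W *ᵥ (D.M *ᵥ Pi.single j 1))) (fun i _ => by
          rw [dotProduct_eq_norm_sq]; positivity) (Finset.mem_compl.2 hj)
    have h4 : 0 ≤ (W *ᵥ (D.M *ᵥ Pi.single j 1)) ⬝ᵥ (W *ᵥ (D.M *ᵥ Pi.single j 1)) := by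
      rw [dotProduct_eq_norm_sq]; positivity
    exact dotProduct_self_eq_zero.1 (by linarith)
  set P : (Fin d → ℝ) → Fin d → ℝ := fun z j => if j ∈ D.Rt t then z j else 0 with hP
  have hPz (z : Fin d → ℝ) : W *ᵥ (D.M *ᵥ z) = W *ᵥ (D.M *ᵥ P z) := by
    have e : z = P z + ∑ j ∈ (D.Rt t)ᶜ, z j • (Pi.single j 1 : Fin d → ℝ) := by
      ext i
      simp only [hP, Pi.add_apply, Finset.sum_apply, Pi.smul_apply, Pi.single_apply, smul_eq_mul,
        mul_ite, mul_one, mul_zero, Finset.sum_ite_eq, Finset.mem_compl]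
      split_ifs <;> simp
    conv_lhs => rw [e]
    simp only [Matrix.mulVec_add, Matrix.mulVec_sum, Matrix.mulVec_smul]
    rw [Finset.sum_eq_zero, add_zero]
    intro j hj
    rw [hcol j (Finset.mem_compl.1 hj), smul_zero]
  have hP0 (z : Fin d → ℝ) (j) (hj : j ∉ D.Rt t) : P z j = 0 := by simp [hP, hj]
  intro z w
  -- Polarization: compare the norms of the sum and of the summands.
  have h1 := h (P z + P w) fun j hj => by simp [hP0 _ j hj]
  have h2 := h (P z) (hP0 z)
  have h3 := h (P w) (hP0 w)
  simp only [Matrix.mulVec_add, add_dotProduct, dotProduct_add] at h1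
  rw [dotProduct_comm (W *ᵥ (D.M *ᵥ P w)) (W *ᵥ (D.M *ᵥ P z)), dotProduct_comm (P w) (P z)] at h1
  rw [hPz z, hPz w]
  have h4 : P z ⬝ᵥ P w = ∑ j ∈ D.Rt t, z j * w j := by
    simp only [dotProduct, hP]
    rw [← Finset.sum_subset (Finset.subset_univ (D.Rt t))]
    · exact Finset.sum_congr rfl fun j hj => by simp [hj]
    · intro j _ hj
      simp [hj]
  rw [← h4]
  linarith

lemma selectsFeatures_of_eq (ι : {j : Fin d // j ∈ D.Rt t} ↪ Fin k)
    {W : Matrix (Fin k) (Fin d) ℝ} {Q : Matrix (Fin k) (Fin k) ℝ}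
    (hQ : Q ∈ Matrix.orthogonalGroup (Fin k) ℝ)
    (h : ∀ z : Fin d → ℝ, W *ᵥ (D.M *ᵥ z) = Q *ᵥ
      (∑ j : {j : Fin d // j ∈ D.Rt t}, z j • (Pi.single (ι j) 1 : Fin k → ℝ))) :
    D.SelectsFeatures t W := by
  intro z w
  rw [h, h, dotProduct_mulVec_orthogonal hQ]
  simp only [sum_dotProduct, dotProduct_sum, smul_dotProduct, dotProduct_smul,
    single_dotProduct, Pi.single_apply, ι.injective.eq_iff, smul_eq_mul]
  rw [← Finset.sum_coe_sort (D.Rt t) fun j => z j * w j]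
  simp [mul_comm]

lemma SelectsFeatures.mulVec_eq_sum {W : Matrix (Fin k) (Fin d) ℝ} (h : D.SelectsFeatures t W)
    (z : Fin d → ℝ) :
    W *ᵥ (D.M *ᵥ z) = ∑ j ∈ D.Rt t, z j • (W *ᵥ (D.M *ᵥ Pi.single j 1)) := by
  have hker (j : Fin d) (hj : j ∉ D.Rt t) : W *ᵥ (D.M *ᵥ Pi.single j 1) = 0 := by
    rw [← dotProduct_self_eq_zero, h]
    refine Finset.sum_eq_zero fun i hi => ?_
    rw [Pi.single_apply, if_neg (by rintro rfl; exact hj hi), zero_mul]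
  have hz : z = ∑ j, z j • (Pi.single j 1 : Fin d → ℝ) := by
    ext i; simp [Pi.single_apply]
  conv_lhs => rw [hz]
  simp only [Matrix.mulVec_sum, Matrix.mulVec_smul]
  exact (Finset.sum_subset (Finset.subset_univ (D.Rt t)) fun j _ hj => by
    rw [hker j hj, smul_zero]).symm

/-- The columns of `W M` over `R_t` are orthonormal. Placed at the positions given by `ι` and
completed to an orthonormal basis, they become columns of `Q`. -/
lemma SelectsFeatures.exists_eq (ι : {j : Fin d // j ∈ D.Rt t} ↪ Fin k)
    {W : Matrix (Fin k) (Fin d) ℝ} (h : D.SelectsFeatures t W) :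
    ∃ Q ∈ Matrix.orthogonalGroup (Fin k) ℝ, ∀ z : Fin d → ℝ, W *ᵥ (D.M *ᵥ z) = Q *ᵥ
      (∑ j : {j : Fin d // j ∈ D.Rt t}, z j • (Pi.single (ι j) 1 : Fin k → ℝ)) := by
  let a : {j : Fin d // j ∈ D.Rt t} → EuclideanSpace ℝ (Fin k) :=
    fun j => WithLp.toLp 2 (W *ᵥ (D.M *ᵥ Pi.single j.1 1))
  -- The value `0` off the range of `ι` is immaterial: the basis extension only sees the restriction
  -- to the range.
  let v : Fin k → EuclideanSpace ℝ (Fin k) := Function.extend ι a 0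
  have hv (j) : v (ι j) = a j := ι.injective.extend_apply _ _ _
  have ha : Orthonormal ℝ a := by
    rw [orthonormal_iff_ite]
    intro i j
    have e : inner ℝ (a i) (a j) = (W *ᵥ (D.M *ᵥ Pi.single j.1 1)) ⬝ᵥ
        (W *ᵥ (D.M *ᵥ Pi.single i.1 1)) := by
      simp [a, PiLp.inner_apply, dotProduct]
    rw [e, h, Finset.sum_eq_single_of_mem j.1 j.2 fun x _ hx => by
      rw [Pi.single_apply, if_neg hx, zero_mul]]
    rw [Pi.single_eq_same, one_mul, Pi.single_apply]
    exact if_congr (by rw [Subtype.ext_iff, eq_comm]) rfl rfl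
  have hvo : Orthonormal ℝ ((Set.range ι).domRestrict v) := by
    have e : (Set.range ι).domRestrict v = a ∘ (Equiv.ofInjective ι ι.injective).symm := by
      ext1 ⟨_, j, rfl⟩
      simpa using hv j
    rw [e]
    exact ha.comp _ (Equiv.injective _)
  obtain ⟨b, hb⟩ := hvo.exists_orthonormalBasis_extension_of_card_eq (by simp)
  let Q : Matrix (Fin k) (Fin k) ℝ := Matrix.of fun i j => b j i
  have hQ : Q ∈ Matrix.orthogonalGroup (Fin k) ℝ := by
    rw [Matrix.mem_orthogonalGroup_iff']
    ext i j
    have e := orthonormal_iff_ite.1 b.orthonormal i j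
    rw [PiLp.inner_apply] at e
    rw [Matrix.mul_apply, Matrix.one_apply, ← e]
    simp [Q, mul_comm]
  refine ⟨Q, hQ, fun z => ?_⟩
  rw [h.mulVec_eq_sum, ← Finset.sum_coe_sort]
  simp only [Matrix.mulVec_sum, Matrix.mulVec_smul]
  refine Finset.sum_congr rfl fun j _ => ?_
  congr 1
  ext i
  simp [Q, hb (ι j) ⟨j, rfl⟩, hv, a]

lemma exists_selectsFeatures (D : Model d T s r) (t : Fin T)
    (ι : {j : Fin d // j ∈ D.Rt t} ↪ Fin k) :
    ∃ W : Matrix (Fin k) (Fin d) ℝ, D.SelectsFeatures t W := by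
  let f : (Fin d → ℝ) →ₗ[ℝ] (Fin k → ℝ) := ∑ j : {j : Fin d // j ∈ D.Rt t},
    (LinearMap.proj j.1).smulRight (Pi.single (ι j) 1 : Fin k → ℝ)
  refine ⟨LinearMap.toMatrix' f * D.Mᵀ, selectsFeatures_of_eq ι (one_mem _) fun z => ?_⟩
  rw [← Matrix.mulVec_mulVec, Matrix.mulVec_mulVec z, mul_transpose_self_of_mem D.M_mem,
    Matrix.one_mulVec, Matrix.one_mulVec, LinearMap.toMatrix'_mulVec]
  simp [f]

end Model

/-! ### The minimizers of the contrastive loss -/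

namespace Model

variable {d T s r k : ℕ} (D : Model d T s r) (t : Fin T)

/-- The invariant part of a hidden vector. -/
def invariantPart (z : Fin d → ℝ) : Fin d → ℝ := fun j => if j ∈ D.R then z j else 0

/-- The spurious part of a hidden vector. -/
def spuriousPart (z : Fin d → ℝ) : Fin d → ℝ := fun j => if j ∈ D.R then 0 else z j

lemma invariantPart_add_spuriousPart (z : Fin d → ℝ) :
    D.invariantPart z + D.spuriousPart z = z := by
  ext j
  simp only [invariantPart, spuriousPart, Pi.add_apply]
  split_ifs <;> simp

lemma resample_eq (z w : Fin d → ℝ) :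
    D.resample z w = D.invariantPart z + D.spuriousPart w := by
  ext j
  simp only [invariantPart, spuriousPart, resample, Pi.add_apply]
  split_ifs <;> simp

/-- Changes the sign of the spurious features. -/
def flipSpurious (z : Fin d → ℝ) : Fin d → ℝ := fun j => if j ∈ D.R then z j else -z j

lemma invariantPart_flipSpurious (z : Fin d → ℝ) :
    D.invariantPart (D.flipSpurious z) = D.invariantPart z := by
  ext j
  simp only [invariantPart, flipSpurious]
  split_ifs <;> rfl

lemma spuriousPart_flipSpurious (z : Fin d → ℝ) :
    D.spuriousPart (D.flipSpurious z) = -D.spuriousPart z := by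
  ext j
  simp only [spuriousPart, flipSpurious, Pi.neg_apply]
  split_ifs <;> simp

/-- The product `φ(x)ᵀ φ(x⁺)` as a function of the hidden vectors. -/
def similarity (W : Matrix (Fin k) (Fin d) ℝ) (q : (Fin d → ℝ) × (Fin d → ℝ)) : ℝ :=
  (W *ᵥ (D.M *ᵥ q.1)) ⬝ᵥ (W *ᵥ (D.M *ᵥ D.resample q.1 q.2))

lemma continuous_resample : Continuous fun q : (Fin d → ℝ) × (Fin d → ℝ) => D.resample q.1 q.2 :=
  continuous_pi fun j => by unfold resample; split_ifs <;> fun_prop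

lemma continuous_invariantPart : Continuous D.invariantPart :=
  continuous_pi fun j => by unfold invariantPart; split_ifs <;> fun_prop

lemma continuous_mulVec {m n : ℕ} (A : Matrix (Fin m) (Fin n) ℝ) : Continuous fun v => A *ᵥ v :=
  Continuous.matrix_mulVec continuous_const continuous_id

lemma continuous_similarity (W : Matrix (Fin k) (Fin d) ℝ) : Continuous (D.similarity W) := by
  have h1 := (continuous_mulVec W).comp (continuous_mulVec D.M)
  exact (h1.comp continuous_fst).dotProduct (h1.comp D.continuous_resample)

lemma integral_inputLaw (W : Matrix (Fin k) (Fin d) ℝ) : ∫ x, W *ᵥ x ∂D.inputLaw t = 0 := by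
  rw [inputLaw, integral_map (continuous_mulVec D.M).measurable.aemeasurable
    (continuous_mulVec W).aestronglyMeasurable]
  exact D.integral_of_odd t fun z => by rw [Matrix.mulVec_neg, Matrix.mulVec_neg]

lemma contrastiveLoss_eq {ℓ : ℝ → ℝ} (hℓ : Continuous ℓ) (W : Matrix (Fin k) (Fin d) ℝ) :
    D.contrastiveLoss ℓ t W
      = expect ((D.hiddenLaw t).prod (D.hiddenLaw t)) fun q => ℓ (D.similarity W q) := by
  unfold contrastiveLoss pairLaw
  simp only [integral_inputLaw, sub_zero]
  rw [expect_map]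
  · rfl
  · exact (((continuous_mulVec D.M).comp continuous_fst).prodMk
      ((continuous_mulVec D.M).comp D.continuous_resample)).measurable
  · exact (hℓ.comp (((continuous_mulVec W).comp continuous_fst).dotProduct
      ((continuous_mulVec W).comp continuous_snd))).measurable

lemma memLp_linear {n : ℕ} (A : Matrix (Fin n) (Fin d) ℝ) (i : Fin n) :
    MemLp (fun z : Fin d → ℝ => (A *ᵥ z) i) 2 (D.hiddenLaw t) := by
  simp only [Matrix.mulVec, dotProduct]
  exact memLp_finsetSum _ fun j _ => (D.memLp_feature t j).const_mul _

lemma integrable_similarity (W : Matrix (Fin k) (Fin d) ℝ) :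
    Integrable (D.similarity W) ((D.hiddenLaw t).prod (D.hiddenLaw t)) := by
  unfold similarity
  simp only [dotProduct]
  have hR (j : Fin d) : MemLp (fun q : (Fin d → ℝ) × (Fin d → ℝ) => D.resample q.1 q.2 j) 2
      ((D.hiddenLaw t).prod (D.hiddenLaw t)) := by
    unfold resample
    split_ifs
    · exact (D.memLp_feature t j).comp_fst _
    · exact (D.memLp_feature t j).comp_snd _
  refine integrable_finsetSum _ fun i _ => MemLp.integrable_mul (p := 2) (q := 2) ?_ ?_
  · simp only [Matrix.mulVec_mulVec]
    exact (D.memLp_linear t (W * D.M) i).comp_fst _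
  · simp only [Matrix.mulVec_mulVec]
    simp only [Matrix.mulVec, dotProduct]
    exact memLp_finsetSum _ fun j _ => (hR j).const_mul _

section Loss

variable {ℓ : ℝ → ℝ}

/-- With `a` the image of the invariant part and `b`, `b'` those of the spurious parts of `z` and
`w`, the four similarities are `(a ± b) ⬝ᵥ (a ± b')`, whose average is `a ⬝ᵥ a`. -/
lemma similarity_average_le (hconv : ConvexOn ℝ Set.univ ℓ)
    (W : Matrix (Fin k) (Fin d) ℝ) (z w : Fin d → ℝ) :
    ℓ ((W *ᵥ (D.M *ᵥ D.invariantPart z)) ⬝ᵥ (W *ᵥ (D.M *ᵥ D.invariantPart z)))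
      ≤ (ℓ (D.similarity W (z, w)) + ℓ (D.similarity W (D.flipSpurious z, w))
        + ℓ (D.similarity W (z, -w)) + ℓ (D.similarity W (D.flipSpurious z, -w))) / 4 := by
  refine (le_of_eq (congrArg ℓ ?_)).trans (four_point_convexity hconv _ _ _ _)
  have hs (w : Fin d → ℝ) : D.spuriousPart (-w) = -D.spuriousPart w := by
    ext j
    simp only [spuriousPart, Pi.neg_apply]
    split_ifs <;> simp
  have e (z : Fin d → ℝ) : W *ᵥ (D.M *ᵥ z)
      = W *ᵥ (D.M *ᵥ D.invariantPart z) + W *ᵥ (D.M *ᵥ D.spuriousPart z) := by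
    rw [← Matrix.mulVec_add, ← Matrix.mulVec_add, invariantPart_add_spuriousPart]
  simp only [similarity, resample_eq]
  rw [e z, e (D.flipSpurious z)]
  simp only [invariantPart_flipSpurious, spuriousPart_flipSpurious, hs, Matrix.mulVec_add,
    Matrix.mulVec_neg, add_dotProduct, dotProduct_add, neg_dotProduct, dotProduct_neg]
  ring

lemma integrable_invariantPart_sq :
    Integrable (fun z => D.invariantPart z ⬝ᵥ D.invariantPart z) (D.hiddenLaw t) := by
  simp only [dotProduct]
  refine integrable_finsetSum _ fun j _ => ?_
  unfold invariantPart
  split_ifs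
  · exact (D.memLp_feature t j).integrable_mul (D.memLp_feature t j)
  · simp

/-- On nonnegative arguments `ℓ` lies between a linear function and `ℓ 0`, and the invariant part
has a finite second moment. -/
lemma integrable_loss_of_le (hconv : ConvexOn ℝ Set.univ ℓ) (hdecr : Antitone ℓ)
    {v : (Fin d → ℝ) → ℝ} (hv : Continuous v) (hv0 : ∀ z, 0 ≤ v z)
    (hle : ∀ z, v z ≤ D.invariantPart z ⬝ᵥ D.invariantPart z) :
    Integrable (fun z => ℓ (v z)) (D.hiddenLaw t) := by
  refine Integrable.mono' (((integrable_const |ℓ 0|)).add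
    ((D.integrable_invariantPart_sq t).const_mul (ℓ (-1) - ℓ 0)))
    ((convex_continuous hconv).comp hv).aestronglyMeasurable (ae_of_all _ fun z => ?_)
  have hC : 0 ≤ ℓ (-1) - ℓ 0 := sub_nonneg.2 (hdecr (by norm_num))
  have h1 := sub_mul_abs_le_of_convex_antitone hconv hdecr (v z)
  have h2 := hdecr (hv0 z)
  have h3 := mul_le_mul_of_nonneg_left (hle z) hC
  have h4 := mul_nonneg hC (hv0 z)
  rw [abs_of_nonneg (hv0 z)] at h1
  simp only [Pi.add_apply, Real.norm_eq_abs]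
  refine abs_le.2 ⟨?_, ?_⟩ <;> linarith [neg_abs_le (ℓ 0), le_abs_self (ℓ 0)]

/-- At negative similarities `ℓ` may grow too fast to be integrable. The loss is then `⊤`, which is
harmless in a lower bound. -/
lemma integrable_or_contrastiveLoss_eq_top (hconv : ConvexOn ℝ Set.univ ℓ)
    (hdecr : Antitone ℓ) (W : Matrix (Fin k) (Fin d) ℝ) :
    Integrable (fun q => ℓ (D.similarity W q)) ((D.hiddenLaw t).prod (D.hiddenLaw t)) ∨
      D.contrastiveLoss ℓ t W = ⊤ := by
  have hℓ := convex_continuous hconv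
  rw [D.contrastiveLoss_eq t hℓ]
  refine integrable_or_expect_eq_top (hℓ.comp (D.continuous_similarity W)).measurable
    ((integrable_const (ℓ 0)).sub ((D.integrable_similarity t W).abs.const_mul (ℓ (-1) - ℓ 0)))
    fun q => sub_mul_abs_le_of_convex_antitone hconv hdecr _

/-- All four sign changes preserve the product law, so the four terms of `similarity_average_le`
have equal integrals. -/
lemma integral_le_integral_similarity (hconv : ConvexOn ℝ Set.univ ℓ)
    (W : Matrix (Fin k) (Fin d) ℝ)
    (hint : Integrable (fun q => ℓ (D.similarity W q)) ((D.hiddenLaw t).prod (D.hiddenLaw t)))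
    (hi : Integrable (fun z => ℓ ((W *ᵥ (D.M *ᵥ D.invariantPart z)) ⬝ᵥ
      (W *ᵥ (D.M *ᵥ D.invariantPart z)))) (D.hiddenLaw t)) :
    ∫ z, ℓ ((W *ᵥ (D.M *ᵥ D.invariantPart z)) ⬝ᵥ (W *ᵥ (D.M *ᵥ D.invariantPart z))) ∂D.hiddenLaw t
      ≤ ∫ q, ℓ (D.similarity W q) ∂((D.hiddenLaw t).prod (D.hiddenLaw t)) := by
  set ν := D.hiddenLaw t
  have hflip : MeasurePreserving D.flipSpurious ν ν := D.measurePreserving_signs t (· ∈ D.R)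
  have hneg : MeasurePreserving (fun z : Fin d → ℝ => -z) ν ν := D.measurePreserving_neg t
  have hid := MeasurePreserving.id ν
  have tr {a b : (Fin d → ℝ) → Fin d → ℝ} (ha : MeasurePreserving a ν ν)
      (hb : MeasurePreserving b ν ν) :
      Integrable (fun q : (Fin d → ℝ) × (Fin d → ℝ) => ℓ (D.similarity W (a q.1, b q.2)))
        (ν.prod ν) ∧
      ∫ q : (Fin d → ℝ) × (Fin d → ℝ), ℓ (D.similarity W (a q.1, b q.2)) ∂(ν.prod ν)
        = ∫ q, ℓ (D.similarity W q) ∂(ν.prod ν) := by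
    have h := ha.prod hb
    refine ⟨h.integrable_comp_of_integrable hint, ?_⟩
    have e := integral_map (μ := ν.prod ν) h.measurable.aemeasurable
      (f := fun q => ℓ (D.similarity W q)) (by rw [h.map_eq]; exact hint.1)
    rw [h.map_eq] at e
    exact e.symm
  have e1 := tr hid hid
  have e2 := tr hflip hid
  have e3 := tr hid hneg
  have e4 := tr hflip hneg
  have i12 := e1.1.add e2.1
  have i123 := i12.add e3.1
  have key := integral_mono (hi.comp_fst ν) ((i123.add e4.1).div_const 4)
    fun q => D.similarity_average_le hconv W q.1 q.2
  rw [integral_div, integral_add' i123 e4.1, integral_add' i12 e3.1, integral_add' e1.1 e2.1,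
    e1.2, e2.2, e3.2, e4.2] at key
  rw [integral_fun_fst (f := fun z => ℓ ((W *ᵥ (D.M *ᵥ D.invariantPart z)) ⬝ᵥ
      (W *ᵥ (D.M *ᵥ D.invariantPart z))))] at key
  simp only [probReal_univ, one_smul] at key
  linarith

lemma continuous_sq_invariantPart (W : Matrix (Fin k) (Fin d) ℝ) :
    Continuous fun z => (W *ᵥ (D.M *ᵥ D.invariantPart z)) ⬝ᵥ (W *ᵥ (D.M *ᵥ D.invariantPart z)) := by
  have h1 := ((continuous_mulVec W).comp (continuous_mulVec D.M)).comp D.continuous_invariantPart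
  exact h1.dotProduct h1

/-- The least possible value of the contrastive loss. -/
noncomputable def minLoss (ℓ : ℝ → ℝ) : ℝ :=
  ∫ z, ℓ (D.invariantPart z ⬝ᵥ D.invariantPart z) ∂D.hiddenLaw t

/-- The sign averaging is followed by the contraction `‖WMz‖ ≤ ‖z‖`. At the minimum the pointwise
inequality of the second step integrates to an equality, hence is one almost surely; equality in the
convexity step is not examined. -/
lemma minLoss_le_contrastiveLoss (hconv : ConvexOn ℝ Set.univ ℓ) (hdecr : Antitone ℓ)
    {W : Matrix (Fin k) (Fin d) ℝ} (hW : W ∈ repClass d k r) :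
    (D.minLoss t ℓ : EReal) ≤ D.contrastiveLoss ℓ t W ∧
      (D.contrastiveLoss ℓ t W ≤ D.minLoss t ℓ →
        (fun z => ℓ ((W *ᵥ (D.M *ᵥ D.invariantPart z)) ⬝ᵥ (W *ᵥ (D.M *ᵥ D.invariantPart z))))
          =ᵐ[D.hiddenLaw t] fun z => ℓ (D.invariantPart z ⬝ᵥ D.invariantPart z)) := by
  have i1 := D.integrable_loss_of_le t hconv hdecr (D.continuous_sq_invariantPart W)
    (fun z => by rw [dotProduct_eq_norm_sq]; positivity)
    (fun z => D.mulVec_dotProduct_self_le hW _)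
  have i2 := D.integrable_loss_of_le t hconv hdecr
    (D.continuous_invariantPart.dotProduct D.continuous_invariantPart)
    (fun z => by rw [dotProduct_eq_norm_sq]; positivity) (fun z => le_rfl)
  have hle (z : Fin d → ℝ) := hdecr (D.mulVec_dotProduct_self_le hW (D.invariantPart z))
  have hint := integral_mono i2 i1 hle
  rcases D.integrable_or_contrastiveLoss_eq_top t hconv hdecr W with h | h
  · have h1 := D.integral_le_integral_similarity t hconv W h i1
    rw [D.contrastiveLoss_eq t (convex_continuous hconv), expect_eq_integral h,
      EReal.coe_le_coe_iff, EReal.coe_le_coe_iff]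
    refine ⟨hint.trans h1, fun h2 => ?_⟩
    refine ((integral_eq_iff_of_ae_le i2 i1 (ae_of_all _ hle)).1 ?_).symm
    exact le_antisymm hint (h1.trans h2)
  · rw [h]
    exact ⟨le_top, fun h2 => absurd h2 (by simp)⟩

/-- Resampling does not touch `R_t`, and almost surely the invariant part is supported there, so the
similarity is its squared norm. -/
lemma SelectsFeatures.contrastiveLoss_eq_minLoss {D : Model d T s r} {t : Fin T}
    (hconv : ConvexOn ℝ Set.univ ℓ)
    (hdecr : Antitone ℓ) {W : Matrix (Fin k) (Fin d) ℝ} (hW : D.SelectsFeatures t W) :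
    D.contrastiveLoss ℓ t W = D.minLoss t ℓ := by
  have i2 := D.integrable_loss_of_le t hconv hdecr
    (D.continuous_invariantPart.dotProduct D.continuous_invariantPart)
    (fun z => by rw [dotProduct_eq_norm_sq]; positivity) (fun z => le_rfl)
  have hae : (fun q => ℓ (D.similarity W q)) =ᵐ[(D.hiddenLaw t).prod (D.hiddenLaw t)]
      fun q => ℓ (D.invariantPart q.1 ⬝ᵥ D.invariantPart q.1) := by
    filter_upwards [Measure.quasiMeasurePreserving_fst.ae (D.ae_eq_zero_of_notMem t)] with q hq
    congr 1
    rw [similarity, hW, dotProduct, ← Finset.sum_subset (Finset.subset_univ (D.Rt t))]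
    · refine Finset.sum_congr rfl fun j hj => ?_
      have hR := D.Rt_subset_R t hj
      simp [resample, invariantPart, hR]
    · intro j _ hj
      by_cases hR : j ∈ D.R
      · simp [invariantPart, hR, hq j hR hj]
      · simp [invariantPart, hR]
  rw [D.contrastiveLoss_eq t (convex_continuous hconv), expect_congr_ae hae,
    expect_eq_integral (i2.comp_fst _),
    integral_fun_fst (f := fun z => ℓ (D.invariantPart z ⬝ᵥ D.invariantPart z))]
  simp [minLoss]

/-- The minimizers of the contrastive loss are the isometries of the features of the task. -/
lemma isPretrained_iff_selectsFeatures (hconv : ConvexOn ℝ Set.univ ℓ) (hdecr : Antitone ℓ)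
    (hstrict : ∃ a : ℝ, 0 < a ∧ ℓ a < ℓ 0) (hk : r ≤ k) (W : Matrix (Fin k) (Fin d) ℝ) :
    D.IsPretrained ℓ t W ↔ D.SelectsFeatures t W := by
  constructor
  · rintro ⟨hW, hmin⟩
    obtain ⟨ι⟩ : Nonempty ({j : Fin d // j ∈ D.Rt t} ↪ Fin k) :=
      Function.Embedding.nonempty_of_card_le (by simpa [card_Rt] using hk)
    obtain ⟨W₀, hW₀⟩ := D.exists_selectsFeatures t ι
    have h1 : D.contrastiveLoss ℓ t W ≤ D.minLoss t ℓ := by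
      rw [← hW₀.contrastiveLoss_eq_minLoss hconv hdecr]
      exact hmin hW₀.mem_repClass
    have hae := (D.minLoss_le_contrastiveLoss t hconv hdecr hW).2 h1
    have hℓ := convex_continuous hconv
    refine selectsFeatures_of_isometry hW fun z hz => ?_
    refine eq_of_forall_pos_convex_apply_mul_eq hconv hstrict (D.mulVec_dotProduct_self_le hW z)
      fun c hc => ?_
    -- Scaling `z` by `√c` multiplies both squared norms by `c`, as the ray comparison requires.
    have h2 := D.eq_of_ae_eq t (hℓ.comp (D.continuous_sq_invariantPart W))
      (hℓ.comp (D.continuous_invariantPart.dotProduct D.continuous_invariantPart)) hae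
      (z := √c • z) (fun j _ hj => by simp [hz j hj])
    have h3 : D.invariantPart (√c • z) = √c • z := by
      ext j
      by_cases hR : j ∈ D.R
      · simp [invariantPart, hR]
      · simp [invariantPart, hR, hz j fun h => hR (D.Rt_subset_R t h)]
    simp only [Function.comp_apply, h3, Matrix.mulVec_smul, smul_dotProduct, dotProduct_smul,
      smul_eq_mul, ← mul_assoc, Real.mul_self_sqrt hc.le] at h2
    exact h2
  · intro h
    refine ⟨h.mem_repClass, fun V hV => ?_⟩
    rw [Set.mem_ofPred_eq, h.contrastiveLoss_eq_minLoss hconv hdecr]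
    exact (D.minLoss_le_contrastiveLoss t hconv hdecr hV).1

end Loss

end Model

/-! ### Uniform deviation bounds for linear predictors -/

section Generalization

variable {X : Type*} [MeasurableSpace X] {μ : Measure X} {k : ℕ}

lemma integral_eq_zero_of_odd {τ : X → X} (hτ : MeasurePreserving τ μ μ) {f : X → ℝ}
    (hf : Integrable f μ) (hfτ : ∀ x, f (τ x) = -f x) : ∫ x, f x ∂μ = 0 := by
  have h := integral_map (μ := μ) hτ.measurable.aemeasurable (f := f) (by
    rw [hτ.map_eq]; exact hf.1)
  rw [hτ.map_eq] at h
  simp only [hfτ, integral_neg] at h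
  linarith

variable [IsProbabilityMeasure μ]

/-- The mean norm of a sum of independent copies of a symmetric random vector. -/
lemma integral_norm_sum_le {φ : X → EuclideanSpace ℝ (Fin k)} (hφ : MemLp φ 2 μ) {τ : X → X}
    (hτ : MeasurePreserving τ μ μ) (hφτ : ∀ x, φ (τ x) = -φ x) {r : ℝ}
    (hr : ∫ x, ‖φ x‖ ^ 2 ∂μ ≤ r) (m : ℕ) :
    ∫ x, ‖∑ a, φ (x a)‖ ∂(Measure.pi fun _ : Fin m => μ) ≤ √(m * r) := by
  set ν := Measure.pi fun _ : Fin m => μ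
  have hc (i : Fin k) : MemLp (fun x => φ x i) 2 μ :=
    hφ.of_le ((EuclideanSpace.proj (𝕜 := ℝ) i).continuous.comp_aestronglyMeasurable hφ.1)
      (ae_of_all _ fun x => PiLp.norm_apply_le _ _)
  have hsum : MemLp (fun x : Fin m → X => ∑ a, φ (x a)) 2 ν :=
    memLp_finsetSum _ fun a _ => hφ.comp_measurePreserving (measurePreserving_eval _ a)
  have hsumc (i : Fin k) : MemLp (fun x : Fin m → X => ∑ a, φ (x a) i) 2 ν :=
    memLp_finsetSum _ fun a _ =>
      (hc i).comp_measurePreserving (measurePreserving_eval (fun _ : Fin m => μ) a)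
  have h0 (i : Fin k) : ∫ x, φ x i ∂μ = 0 :=
    integral_eq_zero_of_odd hτ ((hc i).integrable one_le_two) fun x => by rw [hφτ]; rfl
  -- Coordinates of `φ` have mean zero by symmetry, so second moments are variances and add over
  -- independent copies.
  have hvar (i : Fin k) : ∫ x : Fin m → X, (∑ a, φ (x a) i) ^ 2 ∂ν = m * ∫ x, φ x i ^ 2 ∂μ := by
    have h1 := variance_sum_pi (μ := fun _ : Fin m => μ) (X := fun _ x => φ x i) fun _ => hc i
    have e : (∑ a : Fin m, fun ω : Fin m → X => φ (ω a) i) = fun ω => ∑ a, φ (ω a) i := by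
      ext ω; simp
    rw [e, variance_of_integral_eq_zero (hsumc i).1.aemeasurable] at h1
    · rw [h1]
      simp only [variance_of_integral_eq_zero (hc i).1.aemeasurable (h0 i)]
      simp
    · rw [integral_finsetSum _ fun a _ => integrable_comp_eval (μ := fun _ : Fin m => μ)
        ((hc i).integrable one_le_two)]
      refine Finset.sum_eq_zero fun a _ => ?_
      rw [integral_comp_eval (μ := fun _ : Fin m => μ) (hc i).1, h0]
  have hsq : ∫ x : Fin m → X, ‖∑ a, φ (x a)‖ ^ 2 ∂ν ≤ m * r := by
    simp only [EuclideanSpace.real_norm_sq_eq] at hr ⊢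
    rw [integral_finsetSum _ fun i _ => (hc i).integrable_sq] at hr
    simp only [WithLp.ofLp_sum, Finset.sum_apply]
    rw [integral_finsetSum _ fun i _ => (hsumc i).integrable_sq,
      Finset.sum_congr rfl fun i _ => hvar i,   ← Finset.mul_sum]
    exact mul_le_mul_of_nonneg_left hr (Nat.cast_nonneg m)
  refine Real.le_sqrt_of_sq_le (le_trans ?_ hsq)
  -- A nonnegative variance bounds the squared mean norm by the mean squared norm.
  have h2 := variance_nonneg (fun x : Fin m → X => ‖∑ a, φ (x a)‖) ν
  rw [variance_eq_sub hsum.norm] at h2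
  simp only [Pi.pow_apply] at h2
  linarith

/-- The uniform deviation of finitely many losses exceeds its bound with small probability. -/
lemma measure_iSup_deviation_ge_le {ι : Type*} [Finite ι] [Nonempty ι]
    {φ : X → EuclideanSpace ℝ (Fin k)} (hφm : Measurable φ) (hφ : MemLp φ 2 μ) {τ : X → X}
    (hτ : MeasurePreserving τ μ μ) (hφτ : ∀ x, φ (τ x) = -φ x) {r : ℝ}
    (hr : ∫ x, ‖φ x‖ ^ 2 ∂μ ≤ r) {u : ι → EuclideanSpace ℝ (Fin k)} {B : ℝ} (hu : ∀ i, ‖u i‖ ≤ B)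
    {F : ι → X → ℝ} (hFm : ∀ i, Measurable (F i)) (hF : ∀ i x, |F i x| ≤ 1) (L : ℝ≥0)
    (hFL : ∀ i j x, |F i x - F j x| ≤ L * |inner ℝ (u i - u j) (φ x)|)
    {m : ℕ} (hm : 0 < m) {δ : ℝ} (hδ : 0 < δ) (hδ1 : δ ≤ 1) :
    Measure.pi (fun _ : Fin m => μ)
      {x | 2 * L * B * √(r / m) + √(8 * Real.log (1 / δ) / m)
        ≤ ⨆ i, ((∫ y, F i y ∂μ) - (1 / (m : ℝ)) * ∑ a, F i (x a))} ≤ ENNReal.ofReal δ := by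
  set ν := Measure.pi fun _ : Fin m => μ
  have hm' : (0 : ℝ) < m := Nat.cast_pos.2 hm
  have hB : 0 ≤ B := (norm_nonneg _).trans (hu (Classical.arbitrary ι))
  have hFi (i : ι) : Integrable (F i) μ := integrable_of_measurable_of_abs_le (hFm i) (hF i)
  set G : (Fin m → X) → ℝ := fun x => ⨆ i, ((∫ y, F i y ∂μ) - (1 / (m : ℝ)) * ∑ a, F i (x a))
    with hG
  have hGm : Measurable G := Measurable.iSup fun i => by have := hFm i; fun_prop
  have hEF (i : ι) : |∫ y, F i y ∂μ| ≤ 1 := by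
    have h := norm_integral_le_of_norm_le_const (μ := μ) (f := F i) (C := 1) (ae_of_all _ (hF i))
    simpa using h
  have hGC (x : Fin m → X) : |G x| ≤ 2 := by
    refine abs_iSup_le_of_finite fun i => ?_
    have h1 : |(1 / (m : ℝ)) * ∑ a, F i (x a)| ≤ 1 := by
      rw [abs_mul, abs_of_pos (by positivity), one_div, inv_mul_le_iff₀ hm', mul_one]
      refine (Finset.abs_sum_le_sum_abs _ _).trans ((Finset.sum_le_sum fun a _ => hF i _).trans ?_)
      simp
    exact (abs_sub _ _).trans (by linarith [hEF i])
  have hGd (x : Fin m → X) (b : Fin m) (a : X) : |G (Function.update x b a) - G x| ≤ 2 / m := by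
    have key (i : ι) : |(1 / (m : ℝ)) * ∑ c, F i (Function.update x b a c)
        - (1 / (m : ℝ)) * ∑ c, F i (x c)| ≤ 2 / m := by
      rw [← mul_sub, ← Finset.sum_sub_distrib, Finset.sum_eq_single b]
      · rw [Function.update_self, abs_mul, abs_of_pos (by positivity), one_div, div_eq_inv_mul]
        refine mul_le_mul_of_nonneg_left ?_ (by positivity)
        exact (abs_sub _ _).trans (by linarith [hF i a, hF i (x b)])
      · intro c _ hc
        rw [Function.update_of_ne hc, sub_self]
      · simp
    rw [abs_sub_le_iff]
    constructor
    · rw [sub_le_iff_le_add]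
      refine ciSup_le fun i => ?_
      have h1 := le_iSup_of_finite
        (fun i => (∫ y, F i y ∂μ) - (1 / (m : ℝ)) * ∑ a, F i (x a)) i
      have h2 := (abs_le.1 (key i)).1
      simp only [hG] at h1 ⊢
      linarith
    · rw [sub_le_iff_le_add]
      refine ciSup_le fun i => ?_
      have h1 := le_iSup_of_finite
        (fun i => (∫ y, F i y ∂μ) - (1 / (m : ℝ)) * ∑ c, F i (Function.update x b a c)) i
      have h2 := (abs_le.1 (key i)).2
      simp only [hG] at h1 ⊢
      linarith
  have hEG : ∫ x, G x ∂ν ≤ 2 * L * B * √(r / m) := by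
    -- The linear family dominating the increments of the losses; it is odd under `τ`, and
    -- Cauchy–Schwarz bounds its supremum by the norm of a sum.
    set T : ι → X → ℝ := fun i x => L * inner ℝ (u i) (φ x)
    have hTm (i : ι) : Measurable (T i) := by fun_prop
    have hT (i : ι) : Integrable (T i) μ :=
      ((hφ.integrable one_le_two).const_inner (u i)).const_mul _
    have h1 := integral_iSup_sum_le (μ := μ) (F := fun i x => (∫ y, F i y ∂μ) - F i x)
      (G := fun i x => 2 * T i x) (fun i => by have := hFm i; fun_prop)
      (fun i => (integrable_const _).sub (hFi i)) (fun i => by have := hTm i; fun_prop)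
      (fun i => (hT i).const_mul 2)
      (integral_iSup_centered_le hFm hFi hTm hT (fun i j x => by
        refine (hFL i j x).trans (le_of_eq ?_)
        simp only [T]
        rw [← mul_sub, ← inner_sub_left, abs_mul, NNReal.abs_eq]) hτ
        (fun i x => by simp only [T, hφτ, inner_neg_right, mul_neg])) m 0
    have hnorm : Integrable (fun x : Fin m → X => ‖∑ a, φ (x a)‖) ν :=
      (integrable_finsetSum _ fun a _ => integrable_comp_eval (μ := fun _ : Fin m => μ)
        (hφ.integrable one_le_two)).norm
    have h2 : ∫ x : Fin m → X, ⨆ i, ((0 : ι → ℝ) i + ∑ a, 2 * T i (x a)) ∂ν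
        ≤ ∫ x : Fin m → X, 2 * L * B * ‖∑ a, φ (x a)‖ ∂ν := by
      refine integral_mono ?_ (hnorm.const_mul _) fun x => ciSup_le fun i => ?_
      · exact integrable_iSup_of_finite (fun i => by have := hTm i; fun_prop) fun i =>
          (integrable_const _).add (integrable_finsetSum _ fun a _ =>
            integrable_comp_eval (μ := fun _ : Fin m => μ) ((hT i).const_mul 2))
      · simp only [T, Pi.zero_apply, zero_add, ← Finset.mul_sum, ← inner_sum]
        have h := (real_inner_le_norm (u i) (∑ a, φ (x a))).trans
          (mul_le_mul_of_nonneg_right (hu i) (norm_nonneg _))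
        have h' := mul_le_mul_of_nonneg_left h (show (0 : ℝ) ≤ 2 * L by positivity)
        linarith
    have h3 : ∫ x : Fin m → X, ⨆ i, ((0 : ι → ℝ) i + ∑ a, ((∫ y, F i y ∂μ) - F i (x a))) ∂ν
        = m * ∫ x, G x ∂ν := by
      rw [← integral_const_mul]
      congr 1 with x
      rw [hG, Real.mul_iSup_of_nonneg hm'.le]
      congr 1 with i
      simp only [Pi.zero_apply, Finset.sum_sub_distrib, Finset.sum_const, Finset.card_univ,
        Fintype.card_fin, nsmul_eq_mul]
      field_simp
      ring
    rw [h3] at h1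
    rw [integral_const_mul] at h2
    have h4 := mul_le_mul_of_nonneg_left (integral_norm_sum_le hφ hτ hφτ hr m)
      (show 0 ≤ 2 * L * B by positivity)
    have h5 : √(m * r) = m * √(r / m) := by
      rw [show m * r = (m : ℝ) ^ 2 * (r / m) by field_simp, Real.sqrt_mul (by positivity),
        Real.sqrt_sq hm'.le]
    rw [h5] at h4
    refine le_of_mul_le_mul_left ?_ hm'
    linarith
  -- With differences `2 / m` the tail is `exp (-m ε² / 8)`, which equals `δ` for this `ε`.
  set ε := √(8 * Real.log (1 / δ) / m)
  have hlog : 0 ≤ Real.log (1 / δ) := Real.log_nonneg (by rw [le_div_iff₀ hδ]; linarith)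
  have hε : ε ^ 2 = 8 * Real.log (1 / δ) / m := Real.sq_sqrt (by positivity)
  have h := measureReal_ge_le_of_bounded_differences (μ := μ) hGm hGC hGd (by positivity)
    (ε := ε) (Real.sqrt_nonneg _)
  have e : Real.exp (-ε ^ 2 / (2 * (m * (2 / m) ^ 2))) = δ := by
    rw [hε, show -(8 * Real.log (1 / δ) / m) / (2 * (m * (2 / m) ^ 2)) = - Real.log (1 / δ) by
      field_simp; ring, Real.exp_neg, Real.exp_log (by positivity), one_div, inv_inv]
  rw [e] at h
  have h' := ENNReal.ofReal_le_ofReal h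
  rw [measureReal_def, ENNReal.ofReal_toReal (measure_ne_top _ _)] at h'
  refine (measure_mono fun x hx => ?_).trans h'
  exact (add_le_add_left hEG ε).trans hx

/-- Uniform deviation over a ball of linear predictors. -/
lemma measure_exists_deviation_gt_le
    {φ : X → EuclideanSpace ℝ (Fin k)} (hφm : Measurable φ) (hφ : MemLp φ 2 μ) {τ : X → X}
    (hτ : MeasurePreserving τ μ μ) (hφτ : ∀ x, φ (τ x) = -φ x) {r : ℝ}
    (hr : ∫ x, ‖φ x‖ ^ 2 ∂μ ≤ r) {B : ℝ} (hB : 0 ≤ B)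
    {F : EuclideanSpace ℝ (Fin k) → X → ℝ} (hFm : ∀ u, Measurable (F u))
    (hF : ∀ u x, |F u x| ≤ 1) (L : ℝ≥0)
    (hFL : ∀ u v x, |F u x - F v x| ≤ L * |inner ℝ (u - v) (φ x)|)
    {m : ℕ} (hm : 0 < m) {δ : ℝ} (hδ : 0 < δ) (hδ1 : δ ≤ 1) :
    Measure.pi (fun _ : Fin m => μ)
      {x | ∃ u, ‖u‖ ≤ B ∧ 2 * L * B * √(r / m) + √(8 * Real.log (1 / δ) / m)
        < (∫ y, F u y ∂μ) - (1 / (m : ℝ)) * ∑ a, F u (x a)} ≤ ENNReal.ofReal δ := by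
  set K := 2 * L * B * √(r / m) + √(8 * Real.log (1 / δ) / m)
  have hFc (x : X) : Continuous fun u => F u x := by
    refine LipschitzWith.continuous (K := L * ‖φ x‖₊) (LipschitzWith.of_dist_le_mul fun u v => ?_)
    rw [Real.dist_eq, dist_eq_norm, NNReal.coe_mul, mul_assoc, coe_nnnorm]
    refine (hFL u v x).trans (mul_le_mul_of_nonneg_left ?_ L.2)
    rw [mul_comm]
    exact abs_real_inner_le_norm _ _
  have hEc : Continuous fun u => ∫ y, F u y ∂μ :=
    continuous_of_dominated (fun u => (hFm u).aestronglyMeasurable)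
      (fun u => ae_of_all _ (hF u)) (integrable_const 1) (ae_of_all _ hFc)
  have : Nonempty (Metric.closedBall (0 : EuclideanSpace ℝ (Fin k)) B) := ⟨0, by simpa using hB⟩
  -- The finite bound is independent of the number of predictors, so it passes to the increasing
  -- union of the bad events of initial segments of a dense sequence.
  set v := TopologicalSpace.denseSeq (Metric.closedBall (0 : EuclideanSpace ℝ (Fin k)) B)
  have hv (n : ℕ) : ‖(v n : EuclideanSpace ℝ (Fin k))‖ ≤ B := mem_closedBall_zero_iff.1 (v n).2
  set A : ℕ → Set (Fin m → X) := fun N =>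
    {x | K ≤ ⨆ i : Fin (N + 1), ((∫ y, F (v i) y ∂μ) - (1 / (m : ℝ)) * ∑ a, F (v i) (x a))}
  have hA (N : ℕ) : Measure.pi (fun _ : Fin m => μ) (A N) ≤ ENNReal.ofReal δ :=
    measure_iSup_deviation_ge_le hφm hφ hτ hφτ hr (u := fun i : Fin (N + 1) => v i)
      (fun i => hv i) (fun i => hFm _) (fun i => hF _) L (fun i j => hFL _ _) hm hδ hδ1
  have hmono : Monotone A := by
    intro N N' hN x hx
    refine (Set.mem_ofPred.1 hx).trans (ciSup_le fun i => ?_)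
    exact le_iSup_of_finite (fun i : Fin (N' + 1) =>
      (∫ y, F (v i) y ∂μ) - (1 / (m : ℝ)) * ∑ a, F (v i) (x a)) ⟨i, by omega⟩
  have hU : Measure.pi (fun _ : Fin m => μ) (⋃ N, A N) ≤ ENNReal.ofReal δ := by
    rw [hmono.measure_iUnion]
    exact iSup_le hA
  refine (measure_mono ?_).trans hU
  rintro x ⟨u, hu, hKu⟩
  have hc : Continuous fun w : Metric.closedBall (0 : EuclideanSpace ℝ (Fin k)) B =>
      (∫ y, F w y ∂μ) - (1 / (m : ℝ)) * ∑ a, F w (x a) :=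
    ((hEc.sub (continuous_const.mul (continuous_finsetSum _ fun a _ => hFc (x a))))).comp
      continuous_subtype_val
  -- A strict violation is an open condition on the predictor, so some point of the dense sequence
  -- violates the bound too.
  obtain ⟨_, h1, n, rfl⟩ := (TopologicalSpace.denseRange_denseSeq _).inter_open_nonempty _
    (isOpen_lt continuous_const hc) ⟨⟨u, by simpa using hu⟩, hKu⟩
  refine Set.mem_iUnion.2 ⟨n, Set.mem_ofPred.2 ((le_of_lt h1).trans ?_)⟩
  exact le_iSup_of_finite (fun i : Fin (n + 1) =>
      (∫ y, F (v i) y ∂μ) - (1 / (m : ℝ)) * ∑ a, F (v i) (x a)) (Fin.last n)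

end Generalization

/-! ### Shared features, the least radius and empirical risk minimization -/

namespace Model

variable {d T s r k : ℕ} (D : Model d T s r) (t : Fin T)

lemma continuous_label : Continuous (D.label t) := by unfold label; fun_prop

lemma measurable_input_label : Measurable fun z : Fin d → ℝ => (D.M *ᵥ z, D.label t z) :=
  (continuous_mulVec D.M).measurable.prodMk (D.continuous_label t).measurable

instance taskLaw_isProbabilityMeasure : IsProbabilityMeasure (D.taskLaw t) :=
  Measure.isProbabilityMeasure_map (D.measurable_input_label t).aemeasurable

lemma measurable_loss_linear {ℓc : ℝ → ℝ → ℝ} (hmeas : Measurable (Function.uncurry ℓc))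
    (W : Matrix (Fin k) (Fin d) ℝ) (u : EuclideanSpace ℝ (Fin k)) :
    Measurable fun p : (Fin d → ℝ) × ℝ => ℓc (u.ofLp ⬝ᵥ (W *ᵥ p.1)) p.2 :=
  hmeas.comp ((continuous_const.dotProduct
    ((continuous_mulVec W).comp continuous_fst)).measurable.prodMk measurable_snd)

section SharedFeatures

variable {D t}

/-- On another task, a representation of the features of task `t` only carries the shared ones. -/
lemma SelectsFeatures.exists_risk_eq_sharedRisk {W : Matrix (Fin k) (Fin d) ℝ}
    (h : D.SelectsFeatures t W) {ℓc : ℝ → ℝ → ℝ} (hmeas : Measurable (Function.uncurry ℓc))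
    {i : Fin T} (hi : i ≠ t) (v : EuclideanSpace ℝ (Fin k)) :
    ∃ u : {j : Fin d // j ∈ D.S} → ℝ, D.sharedRisk ℓc i u = D.risk ℓc i W v := by
  refine ⟨fun j => v.ofLp ⬝ᵥ (W *ᵥ (D.M *ᵥ Pi.single j.1 1)), ?_⟩
  unfold sharedRisk risk taskLaw
  rw [expect_map (D.measurable_input_label i) (measurable_loss_linear hmeas W v)]
  refine expect_congr_ae ?_
  filter_upwards [D.ae_eq_zero_of_notMem i] with z hz
  congr 1
  rw [h.mulVec_eq_sum]
  simp only [dotProduct_sum, dotProduct_smul, smul_eq_mul]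
  rw [Finset.sum_coe_sort D.S fun j => v.ofLp ⬝ᵥ (W *ᵥ (D.M *ᵥ Pi.single j 1)) * z j]
  -- The terms over `P_t` drop out: `P_t` is disjoint from `R_i`, so these features vanish almost
  -- surely on task `i`.
  rw [← Finset.sum_subset (s₁ := D.S) (s₂ := D.Rt t) Finset.subset_union_left]
  · exact Finset.sum_congr rfl fun j _ => mul_comm _ _
  · intro j hj hjS
    have hjP : j ∈ D.P t := (Finset.mem_union.1 hj).resolve_left hjS
    rw [hz j (D.Rt_subset_R t hj), zero_mul]
    rw [Rt, Finset.mem_union, not_or]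
    exact ⟨hjS, fun h => Finset.disjoint_left.1 (D.disjoint_P i t hi) h hjP⟩

end SharedFeatures

section Radius

/-- The label weights, extended by zero to all features. -/
def weights (j : Fin d) : ℝ := if h : j ∈ D.S ∪ D.P t then D.ustar t ⟨j, h⟩ else 0

lemma weights_coe (j : {j : Fin d // j ∈ D.S ∪ D.P t}) : D.weights t j = D.ustar t j := by
  simp only [weights, j.2, dif_pos]

lemma label_eq (z : Fin d → ℝ) : D.label t z = ∑ j ∈ D.Rt t, D.weights t j * z j := by
  rw [label, Rt, ← Finset.sum_coe_sort (D.S ∪ D.P t)]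
  simp only [weights_coe]

lemma label_weights : D.label t (D.weights t) = ‖D.ustar t‖ ^ 2 := by
  rw [label, EuclideanSpace.real_norm_sq_eq]
  simp only [weights_coe, sq]

/-- The predictor that realizes the labels with the least norm. -/
def realizer (W : Matrix (Fin k) (Fin d) ℝ) : EuclideanSpace ℝ (Fin k) :=
  WithLp.toLp 2 (W *ᵥ (D.M *ᵥ D.weights t))

variable {D t}

lemma SelectsFeatures.realizer_dotProduct {W : Matrix (Fin k) (Fin d) ℝ}
    (h : D.SelectsFeatures t W) (z : Fin d → ℝ) :
    (D.realizer t W).ofLp ⬝ᵥ (W *ᵥ (D.M *ᵥ z)) = D.label t z := by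
  rw [realizer, h, label_eq]

lemma SelectsFeatures.norm_realizer {W : Matrix (Fin k) (Fin d) ℝ} (h : D.SelectsFeatures t W) :
    ‖D.realizer t W‖ = ‖D.ustar t‖ := by
  have h1 := h.realizer_dotProduct (D.weights t)
  rw [label_weights] at h1
  have h2 : ‖D.realizer t W‖ ^ 2 = ‖D.ustar t‖ ^ 2 := by
    rw [← h1, realizer, ← dotProduct_eq_norm_sq]
  exact (sq_eq_sq₀ (norm_nonneg _) (norm_nonneg _)).1 h2

lemma SelectsFeatures.ae_eq_realizer {W : Matrix (Fin k) (Fin d) ℝ} (h : D.SelectsFeatures t W) :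
    ∀ᵐ p ∂D.taskLaw t, p.2 = (D.realizer t W).ofLp ⬝ᵥ (W *ᵥ p.1) := by
  have hm : MeasurableSet {p : (Fin d → ℝ) × ℝ | p.2 = (D.realizer t W).ofLp ⬝ᵥ (W *ᵥ p.1)} :=
    measurableSet_eq_fun measurable_snd (continuous_const.dotProduct
      ((continuous_mulVec W).comp continuous_fst)).measurable
  rw [taskLaw, ae_map_iff (D.measurable_input_label t).aemeasurable hm]
  exact ae_of_all _ fun z => (h.realizer_dotProduct z).symm

/-- Any realizing `u` reproduces the labels at every vector supported in `R_t`. At the label weights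
this reads `‖u*_t‖² = ⟪u, realizer⟫`, and Cauchy–Schwarz with `norm_realizer` gives `‖u*_t‖ ≤ ‖u‖`.
-/
lemma SelectsFeatures.isLeast_realizingRadii {W : Matrix (Fin k) (Fin d) ℝ}
    (h : D.SelectsFeatures t W) : IsLeast (D.realizingRadii t W) ‖D.ustar t‖ := by
  refine ⟨⟨D.realizer t W, h.norm_realizer.le, h.ae_eq_realizer⟩, ?_⟩
  rintro B ⟨u, hu, hae⟩
  refine le_trans ?_ hu
  have hae' := ae_of_ae_map (D.measurable_input_label t).aemeasurable hae
  have e := D.eq_of_ae_eq t (D.continuous_label t) (continuous_const.dotProduct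
    ((continuous_mulVec W).comp (continuous_mulVec D.M))) hae' (z := D.weights t)
    (fun j _ hj => dif_neg hj)
  rw [label_weights] at e
  have h1 := dotProduct_le_norm_mul_norm u.ofLp (W *ᵥ (D.M *ᵥ D.weights t))
  change _ ≤ ‖u‖ * ‖D.realizer t W‖ at h1
  rw [h.norm_realizer] at h1
  rcases (norm_nonneg (D.ustar t)).eq_or_lt with h0 | h0
  · rw [← h0]; exact norm_nonneg _
  · refine le_of_mul_le_mul_right ?_ h0
    rw [← sq, e]
    exact h1

lemma SelectsFeatures.radius_eq {W : Matrix (Fin k) (Fin d) ℝ} (h : D.SelectsFeatures t W) :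
    D.radius t W = ‖D.ustar t‖ := h.isLeast_realizingRadii.csInf_eq

end Radius

section EmpiricalRisk

/-- Input and label are both linear in the symmetric vector `z`. This is the symmetry `τ` of the
deviation bound. -/
lemma measurePreserving_neg_taskLaw : MeasurePreserving
    (fun p : (Fin d → ℝ) × ℝ => (-p.1, -p.2)) (D.taskLaw t) (D.taskLaw t) := by
  have hm : Measurable fun p : (Fin d → ℝ) × ℝ => (-p.1, -p.2) := by fun_prop
  refine ⟨hm, ?_⟩
  have h := (D.measurePreserving_neg t).map_eq
  unfold taskLaw
  rw [Measure.map_map hm (D.measurable_input_label t)]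
  conv_rhs => rw [← h, Measure.map_map (D.measurable_input_label t) measurable_neg]
  congr 1
  ext z
  · simp [Matrix.mulVec_neg]
  · simp [label]

variable {D t}

/-- The squared norm of `φ` is the sum of `z_j²` over the `r` features of `R_t`, each of variance
one. -/
lemma SelectsFeatures.integral_norm_sq_le {W : Matrix (Fin k) (Fin d) ℝ}
    (h : D.SelectsFeatures t W) :
    MemLp (fun p : (Fin d → ℝ) × ℝ => WithLp.toLp 2 (W *ᵥ p.1)) 2 (D.taskLaw t) ∧
      ∫ p, ‖WithLp.toLp 2 (W *ᵥ p.1)‖ ^ 2 ∂D.taskLaw t ≤ r := by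
  have hc : Continuous fun p : (Fin d → ℝ) × ℝ => WithLp.toLp 2 (W *ᵥ p.1) :=
    (PiLp.continuous_toLp 2 _).comp ((continuous_mulVec W).comp continuous_fst)
  have hsq : Continuous fun p : (Fin d → ℝ) × ℝ => ‖WithLp.toLp 2 (W *ᵥ p.1)‖ ^ 2 := hc.norm.pow 2
  have hz (z : Fin d → ℝ) : ‖WithLp.toLp 2 (W *ᵥ (D.M *ᵥ z))‖ ^ 2 = ∑ j ∈ D.Rt t, z j ^ 2 := by
    rw [← dotProduct_eq_norm_sq, h]
    simp only [sq]
  have hi (j : Fin d) : Integrable (fun z : Fin d → ℝ => z j ^ 2) (D.hiddenLaw t) :=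
    (D.memLp_feature t j).integrable_sq
  constructor
  · rw [memLp_two_iff_integrable_sq_norm hc.aestronglyMeasurable, taskLaw,
      integrable_map_measure hsq.aestronglyMeasurable
        (D.measurable_input_label t).aemeasurable]
    refine (integrable_finsetSum (D.Rt t) fun j _ => hi j).congr (ae_of_all _ fun z => ?_)
    exact (hz z).symm
  · rw [taskLaw, integral_map (D.measurable_input_label t).aemeasurable
      hsq.aestronglyMeasurable]
    simp only [hz]
    rw [integral_finsetSum _ fun j _ => hi j]
    refine (Finset.sum_le_card_nsmul (D.Rt t) _ 1 fun j hj => ?_).trans (by simp [card_Rt])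
    have e : ∫ z : Fin d → ℝ, z j ^ 2 ∂D.hiddenLaw t
        = ∫ x : ℝ, x ^ 2 ∂(gaussianReal 0 1) := by
      have e1 := integral_comp_eval (μ := fun j =>
        if j ∈ D.R ∧ j ∉ D.Rt t then Measure.dirac (0 : ℝ) else gaussianReal 0 1) (i := j)
        (f := fun x : ℝ => x ^ 2) (by fun_prop)
      rwa [if_neg fun h' => h'.2 hj] at e1
    have hv := variance_of_integral_eq_zero (X := id) (μ := gaussianReal 0 1)
      aemeasurable_id (by simp)
    rw [variance_id_gaussianReal] at hv
    rw [e]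
    simpa using hv.ge

/-- The excess risk bound for empirical risk minimization on the representation. -/
lemma SelectsFeatures.measure_not_forall_isERM_le {W : Matrix (Fin k) (Fin d) ℝ}
    (h : D.SelectsFeatures t W) {ℓc : ℝ → ℝ → ℝ} (hmeas : Measurable (Function.uncurry ℓc))
    {L : ℝ≥0} (hLip : ∀ y, LipschitzWith L fun a => ℓc a y) (hb : ∀ a y, |ℓc a y| ≤ 1)
    (h0 : ∀ y, ℓc y y = 0) {m : ℕ} (hm : 0 < m) {δ : ℝ} (hδ : 0 < δ) (hδ1 : δ < 1) :
    Measure.pi (fun _ : Fin m => D.taskLaw t)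
      {smp | ¬ ∀ u : EuclideanSpace ℝ (Fin k), D.IsERM ℓc t W smp u →
        D.risk ℓc t W u ≤
          ((4 * L * √((r : ℝ) / m) * ‖D.ustar t‖ +
            8 * √(2 * Real.log (4 / δ) / m) : ℝ) : EReal)} ≤ ENNReal.ofReal δ := by
  set φ : (Fin d → ℝ) × ℝ → EuclideanSpace ℝ (Fin k) := fun p => WithLp.toLp 2 (W *ᵥ p.1)
  have hφ := h.integral_norm_sq_le
  have hφm : Measurable φ := ((PiLp.continuous_toLp 2 _).comp
    ((continuous_mulVec W).comp continuous_fst)).measurable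
  set F : EuclideanSpace ℝ (Fin k) → (Fin d → ℝ) × ℝ → ℝ :=
    fun u p => ℓc (u.ofLp ⬝ᵥ (W *ᵥ p.1)) p.2
  have hFm (u) : Measurable (F u) := measurable_loss_linear hmeas W u
  have key := measure_exists_deviation_gt_le hφm hφ.1 (D.measurePreserving_neg_taskLaw t)
    (fun p => by simp only [φ, Matrix.mulVec_neg]; rfl) hφ.2 (norm_nonneg (D.ustar t)) hFm
    (fun u p => hb _ _) L (fun u v p => by
      have e := (hLip p.2).dist_le_mul (u.ofLp ⬝ᵥ (W *ᵥ p.1)) (v.ofLp ⬝ᵥ (W *ᵥ p.1))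
      rw [Real.dist_eq, Real.dist_eq, ← sub_dotProduct] at e
      refine e.trans (le_of_eq ?_)
      simp only [φ, PiLp.inner_apply, dotProduct]
      simp [mul_comm]) hm hδ hδ1.le
  have hae : ∀ᵐ smp ∂Measure.pi (fun _ : Fin m => D.taskLaw t),
      empiricalRisk ℓc W smp (D.realizer t W) = 0 := by
    have h1 : ∀ a : Fin m, ∀ᵐ smp ∂Measure.pi (fun _ : Fin m => D.taskLaw t),
        (smp a).2 = (D.realizer t W).ofLp ⬝ᵥ (W *ᵥ (smp a).1) := fun a =>
      (measurePreserving_eval (fun _ : Fin m => D.taskLaw t) a).quasiMeasurePreserving.ae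
        h.ae_eq_realizer
    filter_upwards [ae_all_iff.2 h1] with smp hsmp
    unfold empiricalRisk
    rw [Finset.sum_eq_zero fun a _ => ?_, mul_zero]
    rw [← hsmp a, h0]
  refine (measure_mono_ae ?_).trans key
  filter_upwards [hae] with smp hsmp hbad
  obtain ⟨u, hu⟩ := not_forall.1 (Set.mem_ofPred.1 hbad)
  obtain ⟨⟨hu1, hu2⟩, hu3⟩ := Classical.not_imp.1 hu
  have hrad (w : EuclideanSpace ℝ (Fin k)) : w ∈ D.predictors t W ↔ ‖w‖ ≤ ‖D.ustar t‖ := by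
    rw [predictors, Set.mem_ofPred, h.radius_eq]
  refine Set.mem_ofPred.2 ⟨u, (hrad u).1 hu1, ?_⟩
  -- The realizer is an admissible competitor with zero empirical risk, so the risk of `u` is at
  -- most its deviation.
  have h1 : empiricalRisk ℓc W smp u ≤ 0 :=
    hsmp ▸ isMinOn_iff.1 hu2 _ ((hrad _).2 h.norm_realizer.le)
  rw [risk, expect_eq_integral (integrable_of_measurable_of_abs_le (hFm u) fun p => hb _ _),
    EReal.coe_le_coe_iff, not_le] at hu3
  have hm' : (0 : ℝ) < m := Nat.cast_pos.2 hm
  -- The deviation bound has better constants than required; this and the next estimate only weaken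
  -- it.
  have h2 : 2 * L * ‖D.ustar t‖ * √(r / m) ≤ 4 * L * √((r : ℝ) / m) * ‖D.ustar t‖ := by
    have : 0 ≤ L * ‖D.ustar t‖ * √((r : ℝ) / m) := by positivity
    linarith
  have h3 : √(8 * Real.log (1 / δ) / m) ≤ 8 * √(2 * Real.log (4 / δ) / m) := by
    have hlog : Real.log (1 / δ) ≤ Real.log (4 / δ) :=
      Real.log_le_log (by positivity) (by gcongr; norm_num)
    have hpos : 0 ≤ Real.log (1 / δ) := Real.log_nonneg (by rw [le_div_iff₀ hδ]; linarith)
    rw [show (8 : ℝ) * √(2 * Real.log (4 / δ) / m) = √(8 ^ 2 * (2 * Real.log (4 / δ) / m)) by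
      rw [Real.sqrt_mul (by positivity), Real.sqrt_sq (by norm_num)]]
    refine Real.sqrt_le_sqrt ?_
    rw [← mul_div_assoc]
    refine div_le_div_of_nonneg_right ?_ hm'.le
    linarith
  change 1 / (m : ℝ) * ∑ a, F u (smp a) ≤ 0 at h1
  linarith

end EmpiricalRisk

end Model

end ContrastiveLinear

/-! ### The main theorem -/

theorem proposition2 {d T s r k : ℕ} (D : ContrastiveLinear.Model d T s r) (hk : r ≤ k)
    (ℓ : ℝ → ℝ) (hconv : ConvexOn ℝ Set.univ ℓ) (hdecr : Antitone ℓ)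
    (hstrict : ∃ a : ℝ, 0 < a ∧ ℓ a < ℓ 0)
    (ℓc : ℝ → ℝ → ℝ) (hmeas : Measurable (Function.uncurry ℓc))
    (L : ℝ≥0) (hLip : ∀ y, LipschitzWith L fun a => ℓc a y)
    (t : Fin T) :
    -- the optimal representations are exactly the rotations of the features in `R_t`
    (∀ (ι : {j : Fin d // j ∈ D.Rt t} ↪ Fin k) (W : Matrix (Fin k) (Fin d) ℝ),
      D.IsPretrained ℓ t W ↔
        ∃ Q ∈ Matrix.orthogonalGroup (Fin k) ℝ, ∀ z : Fin d → ℝ,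
          W *ᵥ (D.M *ᵥ z) =
            Q *ᵥ (∑ j : {j : Fin d // j ∈ D.Rt t}, z j • (Pi.single (ι j) 1 : Fin k → ℝ))) ∧
    -- the risk of the empirical risk minimizer on task `t`
    (∀ W : Matrix (Fin k) (Fin d) ℝ, D.IsPretrained ℓ t W →
      IsLeast (D.realizingRadii t W) (D.radius t W) ∧
      ((∀ a y, |ℓc a y| ≤ 1) → (∀ y, ℓc y y = 0) →
        ∀ m : ℕ, 0 < m → ∀ δ : ℝ, 0 < δ → δ < 1 →
          Measure.pi (fun _ : Fin m => D.taskLaw t)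
            {smp | ¬ ∀ u : EuclideanSpace ℝ (Fin k), D.IsERM ℓc t W smp u →
              D.risk ℓc t W u ≤
                ((4 * L * √((r : ℝ) / m) * ‖D.ustar t‖ +
                  8 * √(2 * Real.log (4 / δ) / m) : ℝ) : EReal)} ≤ ENNReal.ofReal δ)) ∧
    -- the error of every linear predictor on another task
    (∀ W : Matrix (Fin k) (Fin d) ℝ, D.IsPretrained ℓ t W →
      ∀ i : Fin T, i ≠ t → ∀ v : EuclideanSpace ℝ (Fin k),
        (⨅ u : {j : Fin d // j ∈ D.S} → ℝ, D.sharedRisk ℓc i u) ≤ D.risk ℓc i W v) := by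
  have hiff := D.isPretrained_iff_selectsFeatures t hconv hdecr hstrict hk
  refine ⟨fun ι W => ?_, fun W hW => ?_, fun W hW i hi v => ?_⟩
  · rw [hiff]
    exact ⟨fun h => h.exists_eq ι, fun ⟨Q, hQ, h⟩ =>
      ContrastiveLinear.Model.selectsFeatures_of_eq ι hQ h⟩
  · have h := (hiff W).1 hW
    refine ⟨h.radius_eq ▸ h.isLeast_realizingRadii, fun hb h0 m hm δ hδ hδ1 => ?_⟩
    exact h.measure_not_forall_isERM_le hmeas hLip hb h0 hm hδ hδ1
  · obtain ⟨u, hu⟩ := ((hiff W).1 hW).exists_risk_eq_sharedRisk hmeas hi v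
    exact (iInf_le _ u).trans hu.le
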